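/- Let $r>0$ and $p\in(0,1)$. Let $F$ be the distribution function of the negative binomial distribution $\mathrm{NB}(r,p)$, i.e. $\mathbb P(X=j)=\frac{\Gamma(j+r)}{j!\,\Gamma(r)}p^j(1-p)^r$ for $j=0,1,2,\dots$, and let $\mathcal F(t)=1-F(t)$ for $t\in\mathbb Z$. Then $\lim_{t\to\infty}\mathcal F(t+1)/\mathcal F(t)=\gamma$ with $\gamma=p$. Let $\mathcal G:\mathbb R\to\mathbb R$ be any continuous nonincreasing function with $\mathcal G(t)=\mathcal F(t)$ for all $t\in\mathbb Z$ (such functions exist), let $x_n$ be any solution of $\mathcal G(x_n)=\frac1n$ for each $n\ge1$ (such solutions exist), and set $$m_n=\Big\lfloor x_n+\tfrac12\Big\rfloor,\qquad p_n=\exp\Big\{-\frac{\mathcal G(m_n)}{\mathcal G(x_n)}\Big\}.$$ For integers $n\ge1$ and $k\ge0$ let $(Y_1,\dots,Y_n)$ be distributed as the symmetric Dirichlet mixture of multinomials with parameters $(k,r)$: draw $\theta=(\theta_1,\dots,\theta_n)$ from the symmetric Dirichlet distribution with hyperparameter $r$ (the law of $(g_1,\dots,g_n)/(g_1+\dots+g_n)$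 for independent $g_i\sim\mathrm{Gamma}(r,1)$) and, given $\theta$, draw $(Y_1,\dots,Y_n)$ from the multinomial distribution with parameters $(k,\theta_1,\dots,\theta_n)$. Let $Y_{(n)}=\max_{1\le i\le n}Y_i$. Then for every $x\in\mathbb Z$, as $n\to\infty$ along pairs $(n,k)$ of integers with $\frac kn=\frac{rp}{1-p}$, $$\mathbb P(Y_{(n)}\le m_n+x)\sim p_n^{\gamma^x},\qquad \gamma=p.$$ -/

import Mathlib

open MeasureTheory ProbabilityTheory Filter Topology Asymptotics

/-- The negative binomial distribution `NB(r, p)` on `ℕ`, with real shape `r`: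
`P(X = j) = Γ(j + r) / (j! Γ(r)) * p ^ j * (1 - p) ^ r`, whose mean is `r p / (1 - p)`. -/
noncomputable def negBinomialMeasure (r p : ℝ) : Measure ℕ :=
  Measure.sum fun j : ℕ =>
    ENNReal.ofReal (Real.Gamma (j + r) / (j.factorial * Real.Gamma r) * p ^ j * (1 - p) ^ r) •
      Measure.dirac j

/-- The tail `1 - F(t) = 1 - P(X ≤ t)`, `t` an integer, for `F` the distribution function of
`X ∼ NB(r, p)`. -/
noncomputable def negBinomialTail (r p : ℝ) (t : ℤ) : ℝ :=
  1 - (negBinomialMeasure r p).real {j : ℕ | (j : ℤ) ≤ t}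

/-- `G` is a continuous nonincreasing extension to the real line of the function `T` on the
integers. -/
structure IsTailExtension (T : ℤ → ℝ) (G : ℝ → ℝ) : Prop where
  eq_tail : ∀ t : ℤ, G t = T t
  continuous : Continuous G
  antitone : Antitone G

/-- `ξ n` solves `G (ξ n) = 1 / n` for every `n ≥ 1`. -/
def IsQuantileSeq (G : ℝ → ℝ) (ξ : ℕ → ℝ) : Prop :=
  ∀ n : ℕ, 1 ≤ n → G (ξ n) = 1 / n

/-- `m_n`, the floor of `ξ_n + 1/2`. -/
noncomputable def centering (ξ : ℕ → ℝ) (n : ℕ) : ℤ := ⌊ξ n + 1 / 2⌋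

/-- `p_n = exp (-θ_n)`, where `θ_n = G (m_n) / G (ξ_n)`. -/
noncomputable def baseProb (G : ℝ → ℝ) (ξ : ℕ → ℝ) (n : ℕ) : ℝ :=
  Real.exp (-(G (centering ξ n) / G (ξ n)))

/-- The symmetric Dirichlet distribution on the standard simplex of `ℝⁿ` with hyperparameter `r`,
as the law of `(g_1, …, g_n) / (g_1 + ⋯ + g_n)` for independent `g_i ∼ Gamma(r, 1)`. -/
noncomputable def symmDirichletMeasure (n : ℕ) (r : ℝ) : Measure (Fin n → ℝ) :=
  (Measure.pi fun _ : Fin n => gammaMeasure r 1).map fun g i => g i / ∑ j, g j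

/-- The multinomial distribution with parameters `(k, θ_1, …, θ_n)`: the law of the box counts when
`k` balls fall independently into `n` boxes, each into box `i` with probability `θ_i`. -/
noncomputable def multinomialMeasure {n : ℕ} (k : ℕ) (θ : Fin n → ℝ) : Measure (Fin n → ℕ) :=
  ∑ y ∈ Finset.piAntidiag Finset.univ k,
    ENNReal.ofReal (Nat.multinomial Finset.univ y * ∏ i, θ i ^ y i) • Measure.dirac y

/-- The multinomial distributions depend measurably on `θ`, so that they can be mixed. -/
theorem measurable_multinomialMeasure {n : ℕ} (k : ℕ) :
    Measurable fun θ : Fin n → ℝ => multinomialMeasure k θ := by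
  refine Measure.measurable_of_measurable_coe _ fun s hs => ?_
  simp only [multinomialMeasure, Measure.finsetSum_apply, Measure.smul_apply, smul_eq_mul]
  refine Finset.measurable_fun_sum _ fun y _ => Measurable.mul_const ?_ _
  exact ENNReal.measurable_ofReal.comp (by fun_prop)

/-- The law of the box counts `(Y_1, …, Y_n)` under the symmetric Dirichlet mixture of multinomials
with parameters `(k, r)`: draw `θ` from the symmetric Dirichlet distribution with hyperparameter
`r`, then draw the counts from the multinomial distribution with parameters `(k, θ)`. -/
noncomputable def dirichletMultinomialMeasure (n k : ℕ) (r : ℝ) : Measure (Fin n → ℕ) :=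
  (symmDirichletMeasure n r).bind fun θ => multinomialMeasure k θ

/-- The maximal box count `Y_(n) = max (Y_1, …, Y_n)`. -/
def maxCount {n : ℕ} (y : Fin n → ℕ) : ℕ := Finset.univ.sup y

/-!
Given the total number `k` of balls, the Dirichlet-multinomial box counts have the law of `n`
independent `NB(r, q)` counts conditioned on their sum being `k`, for every `q ∈ (0, 1)`: both have
weights proportional to `∏ᵢ Γ(yᵢ + r) / (yᵢ! Γ(r))`. For the Dirichlet mixture this is a moment
computation (`lintegral_prod_pow_symmDirichletMeasure`) in which the normalising constant is not
needed.

The conditioning is removed by monotonicity. Let `A(k)` be the probability that no box holds more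
than `t` of the `k` balls. It decreases in `k` (`antitone_cappedProb`), because the generating series
`φ = ∑ Γ(j + r) / (j! Γ(r)) zʲ`, truncated at `j = t`, satisfies the differential equation
`φ' = z φ' + r φ` up to a nonnegative defect. Averaging `A` over the total of independent `NB(r, q)`
counts gives `P_q(X ≤ t) ^ n`. If `q` is slightly above (below) `p`, that total exceeds (falls short
of) `k = n r p / (1 - p)` with high probability by Chebyshev's inequality, so `A(k)` is squeezed
between `P_q(X ≤ t) ^ n` for `q = p + ε` and for `q = p - ε`, up to an error `1 / (n r ε²)`.

The tail `P_q(X > t)` is asymptotic to its leading weight divided by `1 - p`, uniformly for `q` near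
`p` (`tendsto_negBinomialTail_div_weight`, by dominated convergence). This gives the limit `p` of
ratios of consecutive tails, and shows that `q = p ± ε` has the same tail asymptotics as `p` as soon
as `ε t → 0`. Since `t = m_n + x` grows logarithmically in `n`, the choice `ε = 1 / t ^ 2` makes both
errors vanish, and `A(k) ~ exp (-n P(X > t)) ~ exp (-p ^ x n P(X > m_n))`, where `n P(X > m_n)` stays
bounded (`tendsto_cappedProb_mul_exp`).
-/

/-! ### The negative binomial series -/

/-- The coefficient `Γ(k + s) / (k! Γ(s))` of `z ^ k` in `(1 - z) ^ (-s)`. -/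
noncomputable def negBinomialCoeff (s : ℝ) (k : ℕ) : ℝ :=
  Real.Gamma (k + s) / (k.factorial * Real.Gamma s)

theorem negBinomialCoeff_pos {s : ℝ} (hs : 0 < s) (k : ℕ) : 0 < negBinomialCoeff s k := by
  unfold negBinomialCoeff
  have := Real.Gamma_pos_of_pos hs
  have := Real.Gamma_pos_of_pos (show 0 < (k : ℝ) + s by positivity)
  positivity

theorem negBinomialCoeff_zero {s : ℝ} (hs : 0 < s) : negBinomialCoeff s 0 = 1 := by
  have := (Real.Gamma_pos_of_pos hs).ne'
  simp [negBinomialCoeff, this]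

theorem succ_mul_negBinomialCoeff_succ {s : ℝ} (hs : 0 < s) (k : ℕ) :
    (k + 1) * negBinomialCoeff s (k + 1) = (k + s) * negBinomialCoeff s k := by
  have h1 := (Real.Gamma_pos_of_pos hs).ne'
  have h2 : Real.Gamma ((k + 1 : ℕ) + s) = (k + s) * Real.Gamma (k + s) := by
    rw [← Real.Gamma_add_one (by positivity)]; congr 1; push_cast; ring
  have h3 : (k.factorial : ℝ) ≠ 0 := by positivity
  unfold negBinomialCoeff
  rw [h2, Nat.factorial_succ]
  push_cast
  field_simp

theorem succ_mul_negBinomialCoeff_succ' {s : ℝ} (hs : 0 < s) (k : ℕ) :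
    (k + 1) * negBinomialCoeff s (k + 1) = s * negBinomialCoeff (s + 1) k := by
  have h1 := (Real.Gamma_pos_of_pos hs).ne'
  have h2 : Real.Gamma ((k + 1 : ℕ) + s) = Real.Gamma (k + (s + 1)) := by
    congr 1; push_cast; ring
  have h3 : (k.factorial : ℝ) ≠ 0 := by positivity
  unfold negBinomialCoeff
  rw [h2, Nat.factorial_succ, Real.Gamma_add_one hs.ne']
  push_cast
  field_simp

theorem multichoose_eq_negBinomialCoeff {s : ℝ} (hs : 0 < s) (k : ℕ) :
    Ring.multichoose s k = negBinomialCoeff s k := by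
  have key : ∀ k : ℕ, (ascPochhammer ℕ k).smeval s = k.factorial * negBinomialCoeff s k := by
    intro k
    induction k with
    | zero => simp [negBinomialCoeff_zero hs]
    | succ k ih =>
      have h := succ_mul_negBinomialCoeff_succ hs k
      rw [ascPochhammer_succ_right, Polynomial.smeval_mul, ih, Nat.factorial_succ]
      simp only [Polynomial.smeval_add, Polynomial.smeval_X, Polynomial.smeval_natCast]
      push_cast
      simp
      linear_combination (-(k.factorial : ℝ)) * h
  have h := Ring.factorial_nsmul_multichoose_eq_ascPochhammer s k
  rw [key, nsmul_eq_mul] at h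
  exact mul_left_cancel₀ (by positivity) h

theorem hasSum_negBinomialCoeff_mul_pow {s q : ℝ} (hs : 0 < s) (hq0 : 0 < q) (hq1 : q < 1) :
    HasSum (fun k => negBinomialCoeff s k * q ^ k) (1 / (1 - q) ^ s) := by
  have h := (Real.one_div_one_sub_rpow_hasFPowerSeriesOnBall_zero s).hasSum (y := q)
    (by simp [enorm_eq_nnnorm, ← NNReal.coe_lt_one, abs_of_pos hq0, hq1])
  simp only [zero_add, FormalMultilinearSeries.ofScalars_apply_eq, smul_eq_mul] at h
  refine h.congr_fun ?_
  intro k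
  rw [← multichoose_eq_negBinomialCoeff hs, Ring.choose]
  congr 2; ring

/-- The weight of `k` under the negative binomial distribution `NB(s, q)`. -/
noncomputable def negBinomialWeight (s q : ℝ) (k : ℕ) : ℝ :=
  negBinomialCoeff s k * q ^ k * (1 - q) ^ s

theorem negBinomialWeight_pos {s q : ℝ} (hs : 0 < s) (hq0 : 0 < q) (hq1 : q < 1) (k : ℕ) :
    0 < negBinomialWeight s q k := by
  have := negBinomialCoeff_pos hs k
  have := Real.rpow_pos_of_pos (sub_pos.2 hq1) s
  unfold negBinomialWeight; positivity

theorem hasSum_negBinomialWeight {s q : ℝ} (hs : 0 < s) (hq0 : 0 < q) (hq1 : q < 1) :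
    HasSum (negBinomialWeight s q) 1 := by
  have := (Real.rpow_pos_of_pos (sub_pos.2 hq1) s).ne'
  have h := (hasSum_negBinomialCoeff_mul_pow hs hq0 hq1).mul_right ((1 - q) ^ s)
  rwa [one_div, inv_mul_cancel₀ this] at h

theorem hasSum_natCast_mul_negBinomialWeight {s q : ℝ} (hs : 0 < s) (hq0 : 0 < q) (hq1 : q < 1) :
    HasSum (fun k : ℕ => k * negBinomialWeight s q k) (s * q / (1 - q)) := by
  have h1 : 0 < 1 - q := sub_pos.2 hq1
  rw [← hasSum_nat_add_iff' 1]
  have h := (hasSum_negBinomialWeight (s := s + 1) (by positivity) hq0 hq1).mul_left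
    (s * q / (1 - q))
  simp only [Finset.range_one, Finset.sum_singleton, Nat.cast_zero, zero_mul, sub_zero]
  rw [mul_one] at h
  refine h.congr_fun fun k => ?_
  unfold negBinomialWeight
  have e := succ_mul_negBinomialCoeff_succ' hs k
  rw [Real.rpow_add_one h1.ne']
  push_cast
  rw [← mul_assoc, ← mul_assoc, e]
  field_simp
  ring

theorem hasSum_natCast_mul_pred_mul_negBinomialWeight {s q : ℝ} (hs : 0 < s) (hq0 : 0 < q)
    (hq1 : q < 1) :
    HasSum (fun k : ℕ => k * (k - 1) * negBinomialWeight s q k)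
      (s * (s + 1) * q ^ 2 / (1 - q) ^ 2) := by
  have h1 : 0 < 1 - q := sub_pos.2 hq1
  rw [← hasSum_nat_add_iff' 1]
  have h := (hasSum_natCast_mul_negBinomialWeight (s := s + 1) (by positivity) hq0 hq1).mul_left
    (s * q / (1 - q))
  simp only [Finset.range_one, Finset.sum_singleton, Nat.cast_zero, zero_mul, sub_zero]
  rw [show s * (s + 1) * q ^ 2 / (1 - q) ^ 2 = s * q / (1 - q) * ((s + 1) * q / (1 - q)) by
    field_simp]
  refine h.congr_fun fun k => ?_
  unfold negBinomialWeight
  have e := succ_mul_negBinomialCoeff_succ' hs k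
  rw [Real.rpow_add_one h1.ne']
  push_cast
  rw [show ((k : ℝ) + 1) * (k + 1 - 1) * (negBinomialCoeff s (k + 1) * q ^ (k + 1) * (1 - q) ^ s)
    = ((k + 1) * negBinomialCoeff s (k + 1)) * (k * q ^ (k + 1) * (1 - q) ^ s) by ring, e]
  field_simp
  ring

theorem hasSum_sq_sub_mean_mul_negBinomialWeight {s q : ℝ} (hs : 0 < s) (hq0 : 0 < q)
    (hq1 : q < 1) :
    HasSum (fun k : ℕ => (k - s * q / (1 - q)) ^ 2 * negBinomialWeight s q k)
      (s * q / (1 - q) ^ 2) := by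
  have h1 : 0 < 1 - q := sub_pos.2 hq1
  have h := ((hasSum_natCast_mul_pred_mul_negBinomialWeight hs hq0 hq1).add
    ((hasSum_natCast_mul_negBinomialWeight hs hq0 hq1).mul_left (1 - 2 * (s * q / (1 - q))))).add
    ((hasSum_negBinomialWeight hs hq0 hq1).mul_left ((s * q / (1 - q)) ^ 2))
  convert! h using 1
  · ext k; ring
  · field_simp; ring

/-- Chebyshev's inequality for `NB(s, q)`. -/
theorem tsum_indicator_negBinomialWeight_le {s q d : ℝ} (hs : 0 < s) (hq0 : 0 < q) (hq1 : q < 1)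
    (hd : 0 < d) {A : Set ℕ} (hA : ∀ k ∈ A, d ≤ |(k : ℝ) - s * q / (1 - q)|) :
    ∑' k, A.indicator (negBinomialWeight s q) k ≤ s * q / (1 - q) ^ 2 / d ^ 2 := by
  have hsum := (hasSum_sq_sub_mean_mul_negBinomialWeight hs hq0 hq1).div_const (d ^ 2)
  rw [← hsum.tsum_eq]
  refine Summable.tsum_le_tsum (fun k => ?_)
    ((hasSum_negBinomialWeight hs hq0 hq1).summable.indicator A) hsum.summable
  have hw := (negBinomialWeight_pos hs hq0 hq1 k).le
  by_cases hk : k ∈ A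
  · rw [Set.indicator_of_mem hk, le_div_iff₀ (by positivity), mul_comm]
    refine mul_le_mul_of_nonneg_right ?_ hw
    rw [← sq_abs ((k : ℝ) - _)]
    exact pow_le_pow_left₀ hd.le (hA k hk) 2
  · rw [Set.indicator_of_notMem hk]; positivity

/-! ### Boxes of bounded capacity -/

/-- The total weight `∑ ∏ᵢ Γ(yᵢ + r) / (yᵢ! Γ(r))` over the placements `y` of `k` balls into `n`
boxes none of which holds more than `m` balls, as a coefficient of the generating series. -/
noncomputable def cappedWeight (r : ℝ) (n m k : ℕ) : ℝ :=
  PowerSeries.coeff k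
    ((PowerSeries.mk fun j => if j ≤ m then negBinomialCoeff r j else 0) ^ n)

/-- Coefficients of a power of a power series, as sums over the placements of `k` balls. -/
theorem coeff_mk_pow_eq_sum_piAntidiag (a : ℕ → ℝ) (n k : ℕ) :
    PowerSeries.coeff k (PowerSeries.mk a ^ n) =
      ∑ y ∈ Finset.piAntidiag (Finset.univ : Finset (Fin n)) k, ∏ i, a (y i) := by
  have : PowerSeries.mk a ^ n = ∏ _i : Fin n, PowerSeries.mk a := by simp
  rw [this, PowerSeries.coeff_prod]
  refine Finset.sum_bij' (fun l _ => ⇑l) (fun y _ => Finsupp.equivFunOnFinite.symm y) ?_ ?_ ?_ ?_ ?_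
  · intro l hl; simpa using hl
  · intro l hl; simpa using hl
  · intro l hl; ext; simp
  · intro l hl; ext; simp
  · intro l hl; simp

theorem coeff_mk_pow_nonneg {a : ℕ → ℝ} (ha : ∀ j, 0 ≤ a j) (n k : ℕ) :
    0 ≤ PowerSeries.coeff k (PowerSeries.mk a ^ n) := by
  rw [coeff_mk_pow_eq_sum_piAntidiag]
  exact Finset.sum_nonneg fun y _ => Finset.prod_nonneg fun i _ => ha _

theorem hasSum_coeff_mk_pow {a : ℕ → ℝ} (ha : ∀ j, 0 ≤ a j) {q F : ℝ} (hq : 0 ≤ q)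
    (h : HasSum (fun j => a j * q ^ j) F) (n : ℕ) :
    HasSum (fun k => PowerSeries.coeff k (PowerSeries.mk a ^ n) * q ^ k) (F ^ n) := by
  induction n with
  | zero =>
    refine (hasSum_ite_eq (0 : ℕ) (1 : ℝ)).congr_fun fun k => ?_
    rcases eq_or_ne k 0 with rfl | hk <;> simp [PowerSeries.coeff_one, *]
  | succ n ih =>
    have h1 : Summable fun k => ‖PowerSeries.coeff k (PowerSeries.mk a ^ n) * q ^ k‖ := by
      refine ih.summable.congr fun k => ?_
      have := coeff_mk_pow_nonneg ha n k
      rw [Real.norm_of_nonneg (by positivity)]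
    have h2 : Summable fun k => ‖a k * q ^ k‖ := by
      refine h.summable.congr fun k => ?_
      have := ha k
      rw [Real.norm_of_nonneg (by positivity)]
    have e := tsum_mul_tsum_eq_tsum_sum_antidiagonal_of_summable_norm h1 h2
    have hs := summable_norm_sum_mul_antidiagonal_of_summable_norm h1 h2
    rw [ih.tsum_eq, h.tsum_eq] at e
    rw [pow_succ F, e]
    refine (hs.of_norm.hasSum).congr_fun fun k => ?_
    rw [pow_succ, PowerSeries.coeff_mul, Finset.sum_mul]
    refine Finset.sum_congr rfl fun x hx => ?_
    rw [← Finset.HasAntidiagonal.mem_antidiagonal.1 hx, PowerSeries.coeff_mk, pow_add]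
    ring

open PowerSeries in
/-- A series `φ = ∑ aⱼ Xʲ` with `(j + 1) aⱼ₊₁ + eⱼ = (j + r) aⱼ` satisfies `φ' + e = X φ' + r φ`;
differentiating `φ ^ n` turns this into a recursion between consecutive coefficients of `φ ^ n`. -/
theorem coeff_pow_recursion {a e : ℕ → ℝ} {r : ℝ}
    (h : ∀ j, (j + 1) * a (j + 1) + e j = (j + r) * a j) (n k : ℕ) :
    (k + 1) * coeff (k + 1) (mk a ^ (n + 1)) + coeff k (((n : ℝ⟦X⟧) + 1) * mk a ^ n * mk e) =
      (k + (n + 1) * r) * coeff k (mk a ^ (n + 1)) := by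
  have hode : derivative ℝ (mk a) + mk e = X * derivative ℝ (mk a) + C r * mk a := by
    ext j
    have hj := h j
    rcases j with _ | j
    · rw [map_add, map_add, coeff_derivative, coeff_zero_X_mul, coeff_C_mul]
      simp at hj ⊢
      linarith
    · simp [coeff_derivative, coeff_succ_X_mul] at hj ⊢
      linarith
  have hpow : derivative ℝ (mk a ^ (n + 1)) + ((n : ℝ⟦X⟧) + 1) * mk a ^ n * mk e =
      X * derivative ℝ (mk a ^ (n + 1)) + C ((n + 1) * r) * mk a ^ (n + 1) := by
    rw [derivative_pow]
    simp only [Nat.add_sub_cancel, map_mul, map_add, map_natCast, map_one]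
    push_cast
    linear_combination (((n : ℝ⟦X⟧) + 1) * mk a ^ n) * hode
  have hc := congrArg (coeff k) hpow
  have hX : coeff k (X * derivative ℝ (mk a ^ (n + 1))) = k * coeff k (mk a ^ (n + 1)) := by
    rcases k with _ | k
    · simp
    · rw [coeff_succ_X_mul, coeff_derivative]; push_cast; ring
  rw [map_add, map_add, hX, coeff_derivative, coeff_C_mul] at hc
  linarith

theorem coeff_mk_negBinomialCoeff_pow {r : ℝ} (hr : 0 < r) {n : ℕ} (hn : 0 < n) (k : ℕ) :
    PowerSeries.coeff k (PowerSeries.mk (negBinomialCoeff r) ^ n) =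
      negBinomialCoeff (n * r) k := by
  obtain ⟨n, rfl⟩ := Nat.exists_eq_succ_of_ne_zero hn.ne'
  have hs : 0 < ((n.succ : ℕ) : ℝ) * r := by positivity
  induction k with
  | zero => rw [negBinomialCoeff_zero hs]; simp [negBinomialCoeff_zero hr]
  | succ k ih =>
    have h := coeff_pow_recursion (a := negBinomialCoeff r) (e := 0) (r := r)
      (fun j => by simpa using succ_mul_negBinomialCoeff_succ hr j) n k
    have h0 : PowerSeries.mk (0 : ℕ → ℝ) = 0 := by ext; simp
    have h' := succ_mul_negBinomialCoeff_succ hs k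
    rw [h0, mul_zero, map_zero, add_zero] at h
    rw [Nat.succ_eq_add_one] at *
    rw [ih] at h
    push_cast at h h' ⊢
    have : (0 : ℝ) < k + 1 := by positivity
    exact mul_left_cancel₀ this.ne' (h.trans h'.symm)

theorem cappedWeight_nonneg {r : ℝ} (hr : 0 < r) (n m k : ℕ) : 0 ≤ cappedWeight r n m k := by
  refine coeff_mk_pow_nonneg (fun j => ?_) n k
  split_ifs
  exacts [(negBinomialCoeff_pos hr j).le, le_rfl]

theorem cappedWeight_le {r : ℝ} (hr : 0 < r) {n : ℕ} (hn : 0 < n) (m k : ℕ) :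
    cappedWeight r n m k ≤ negBinomialCoeff (n * r) k := by
  rw [← coeff_mk_negBinomialCoeff_pow hr hn, cappedWeight, coeff_mk_pow_eq_sum_piAntidiag,
    coeff_mk_pow_eq_sum_piAntidiag]
  refine Finset.sum_le_sum fun y _ => Finset.prod_le_prod (fun i _ => ?_) fun i _ => ?_
  · split_ifs
    exacts [(negBinomialCoeff_pos hr _).le, le_rfl]
  · split_ifs
    exacts [le_rfl, (negBinomialCoeff_pos hr _).le]

theorem succ_mul_cappedWeight_succ_le {r : ℝ} (hr : 0 < r) {n : ℕ} (hn : 0 < n) (m k : ℕ) :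
    (k + 1) * cappedWeight r n m (k + 1) ≤ (k + n * r) * cappedWeight r n m k := by
  obtain ⟨n, rfl⟩ := Nat.exists_eq_succ_of_ne_zero hn.ne'
  -- the recursion of the coefficients fails only at the cap, where it leaves a nonnegative defect
  have h := coeff_pow_recursion (a := fun j => if j ≤ m then negBinomialCoeff r j else 0)
    (e := fun j => if j = m then (m + r) * negBinomialCoeff r m else 0) (r := r) (fun j => by
      have := succ_mul_negBinomialCoeff_succ hr j
      rcases lt_trichotomy j m with hj | rfl | hj
      · simpa [hj.ne, hj.le, Nat.succ_le_of_lt hj] using this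
      · simp
      · simp [hj.ne', hj.not_ge, (hj.trans (Nat.lt_succ_self j)).not_ge]) n k
  have h0 : 0 ≤ PowerSeries.coeff k (((n : PowerSeries ℝ) + 1) *
      (PowerSeries.mk fun j => if j ≤ m then negBinomialCoeff r j else 0) ^ n *
      PowerSeries.mk fun j => if j = m then (m + r) * negBinomialCoeff r m else 0) := by
    have e : (n : PowerSeries ℝ) + 1 = PowerSeries.C ((n : ℝ) + 1) := by simp
    rw [e, mul_assoc, PowerSeries.coeff_C_mul, PowerSeries.coeff_mul]
    refine mul_nonneg (by positivity) (Finset.sum_nonneg fun x _ => mul_nonneg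
      (cappedWeight_nonneg hr n m x.1) ?_)
    have := negBinomialCoeff_pos hr m
    rw [PowerSeries.coeff_mk]; split_ifs <;> positivity
  simp only [cappedWeight, Nat.succ_eq_add_one]
  push_cast
  linarith

/-- The probability that no box holds more than `m` balls, when `k` balls are distributed over `n`
boxes according to the Dirichlet mixture of multinomials. -/
noncomputable def cappedProb (r : ℝ) (n m k : ℕ) : ℝ :=
  cappedWeight r n m k / negBinomialCoeff (n * r) k

theorem cappedProb_nonneg {r : ℝ} (hr : 0 < r) {n : ℕ} (hn : 0 < n) (m k : ℕ) :
    0 ≤ cappedProb r n m k :=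
  div_nonneg (cappedWeight_nonneg hr n m k) (negBinomialCoeff_pos (by positivity) k).le

theorem cappedProb_le_one {r : ℝ} (hr : 0 < r) {n : ℕ} (hn : 0 < n) (m k : ℕ) :
    cappedProb r n m k ≤ 1 :=
  (div_le_one (negBinomialCoeff_pos (by positivity) k)).2 (cappedWeight_le hr hn m k)

/-- Adding balls can only make the maximal box count larger. -/
theorem antitone_cappedProb {r : ℝ} (hr : 0 < r) {n : ℕ} (hn : 0 < n) (m : ℕ) :
    Antitone (cappedProb r n m) := by
  refine antitone_nat_of_succ_le fun k => ?_
  have hs : 0 < (n : ℝ) * r := by positivity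
  have h1 := negBinomialCoeff_pos hs k
  have h2 := succ_mul_negBinomialCoeff_succ hs k
  have h3 := succ_mul_cappedWeight_succ_le hr hn m k
  have hk : (0 : ℝ) < k + 1 := by positivity
  rw [cappedProb, cappedProb, div_le_div_iff₀ (negBinomialCoeff_pos hs _) h1]
  refine le_of_mul_le_mul_left ?_ hk
  calc ((k : ℝ) + 1) * (cappedWeight r n m (k + 1) * negBinomialCoeff (n * r) k)
      = (k + 1) * cappedWeight r n m (k + 1) * negBinomialCoeff (n * r) k := by ring
    _ ≤ (k + n * r) * cappedWeight r n m k * negBinomialCoeff (n * r) k := by gcongr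
    _ = cappedWeight r n m k * ((k + n * r) * negBinomialCoeff (n * r) k) := by ring
    _ = _ := by rw [← h2]; ring

/-- Independent `NB(r, q)` counts are a mixture over the total number of balls `k` of the
distributions conditioned on `k`. -/
theorem hasSum_negBinomialWeight_mul_cappedProb {r q : ℝ} (hr : 0 < r) (hq0 : 0 < q) (hq1 : q < 1)
    {n : ℕ} (hn : 0 < n) (m : ℕ) :
    HasSum (fun k => negBinomialWeight (n * r) q k * cappedProb r n m k)
      ((∑ j ∈ Finset.range (m + 1), negBinomialWeight r q j) ^ n) := by
  have hs : 0 < (n : ℝ) * r := by positivity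
  have h1 : 0 < 1 - q := sub_pos.2 hq1
  have hF : HasSum (fun j => (if j ≤ m then negBinomialCoeff r j else 0) * q ^ j)
      (∑ j ∈ Finset.range (m + 1), negBinomialCoeff r j * q ^ j) := by
    rw [Finset.sum_congr rfl (g := fun j => (if j ≤ m then negBinomialCoeff r j else 0) * q ^ j)
      (fun j hj => by rw [if_pos (Nat.lt_succ_iff.1 (Finset.mem_range.1 hj))])]
    refine hasSum_sum_of_ne_finset_zero fun j hj => ?_
    rw [if_neg fun h => hj (Finset.mem_range.2 (Nat.lt_succ_iff.2 h)), zero_mul]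
  have h := (hasSum_coeff_mk_pow (fun j => by
    split_ifs
    exacts [(negBinomialCoeff_pos hr j).le, le_rfl]) hq0.le hF n).mul_right
    ((1 - q) ^ ((n : ℝ) * r))
  have e : (∑ j ∈ Finset.range (m + 1), negBinomialWeight r q j) ^ n =
      (∑ j ∈ Finset.range (m + 1), negBinomialCoeff r j * q ^ j) ^ n *
        (1 - q) ^ ((n : ℝ) * r) := by
    simp only [negBinomialWeight]
    rw [← Finset.sum_mul, mul_pow, mul_comm (n : ℝ), Real.rpow_mul h1.le, Real.rpow_natCast]
  rw [e]
  refine h.congr_fun fun k => ?_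
  have := (negBinomialCoeff_pos hs k).ne'
  rw [cappedProb, cappedWeight, negBinomialWeight]
  field_simp

/-! ### The Dirichlet mixture of multinomials -/

theorem measurable_gammaPDF (a r : ℝ) : Measurable (gammaPDF a r) :=
  (measurable_gammaPDFReal a r).ennreal_ofReal

theorem ae_pos_gammaMeasure (r : ℝ) : ∀ᵐ x ∂gammaMeasure r 1, 0 < x := by
  rw [gammaMeasure, ae_withDensity_iff (measurable_gammaPDF r 1)]
  filter_upwards [Measure.ae_ne volume (0 : ℝ)] with x hx h
  by_contra hneg
  exact h (gammaPDF_of_neg (lt_of_le_of_ne (not_lt.1 hneg) hx))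

theorem lintegral_pow_mul_exp_gammaMeasure {r l : ℝ} (hr : 0 < r) (hl : 0 ≤ l) (y : ℕ) :
    ∫⁻ x, ENNReal.ofReal (x ^ y * Real.exp (-(l * x))) ∂gammaMeasure r 1 =
      ENNReal.ofReal (Real.Gamma (y + r) / Real.Gamma r / (1 + l) ^ (y + r)) := by
  have hG := Real.Gamma_pos_of_pos hr
  have hG' := Real.Gamma_pos_of_pos (show 0 < (y : ℝ) + r by positivity)
  have hl' : 0 < (1 + l) ^ (y + r) := Real.rpow_pos_of_pos (by positivity) _
  rw [gammaMeasure, lintegral_withDensity_eq_lintegral_mul _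
    (measurable_gammaPDF r 1) (by fun_prop)]
  have h : ∀ᵐ x : ℝ, (gammaPDF r 1 * fun x => ENNReal.ofReal (x ^ y * Real.exp (-(l * x)))) x =
      ENNReal.ofReal (Real.Gamma (y + r) / Real.Gamma r / (1 + l) ^ (y + r)) *
        gammaPDF (y + r) (1 + l) x := by
    filter_upwards [Measure.ae_ne volume (0 : ℝ)] with x hx
    rcases lt_or_gt_of_ne hx with hx | hx
    · simp [gammaPDF_of_neg hx]
    · have e1 : x ^ ((y : ℝ) + r - 1) = x ^ y * x ^ (r - 1) := by
        rw [add_sub_assoc, Real.rpow_add hx, Real.rpow_natCast]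
      have e2 : Real.exp (-((1 + l) * x)) = Real.exp (-(1 * x)) * Real.exp (-(l * x)) := by
        rw [← Real.exp_add]; congr 1; ring
      rw [Pi.mul_apply, gammaPDF_of_nonneg hx.le, gammaPDF_of_nonneg hx.le,
        ← ENNReal.ofReal_mul (by positivity), ← ENNReal.ofReal_mul (by positivity), e1, e2,
        Real.one_rpow]
      congr 1
      field_simp
  rw [lintegral_congr_ae h, lintegral_const_mul _ (measurable_gammaPDF _ _),
    lintegral_gammaPDF_eq_one (by positivity) (by positivity), mul_one]

theorem ae_pi_gammaMeasure_pos {r : ℝ} (hr : 0 < r) (n : ℕ) :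
    ∀ᵐ g ∂(Measure.pi fun _ : Fin n => gammaMeasure r 1), ∀ i, 0 < g i := by
  have := isProbabilityMeasure_gammaMeasure hr one_pos
  exact eventually_all.2 fun i => Measure.tendsto_eval_ae_ae.eventually (ae_pos_gammaMeasure r)

theorem lintegral_prod_pow_mul_exp_pi_gammaMeasure {r l : ℝ} (hr : 0 < r) (hl : 0 ≤ l) {n : ℕ}
    (y : Fin n → ℕ) :
    ∫⁻ g, ∏ i, ENNReal.ofReal (g i ^ y i * Real.exp (-(l * g i)))
        ∂(Measure.pi fun _ : Fin n => gammaMeasure r 1) =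
      ∏ i, ENNReal.ofReal (Real.Gamma (y i + r) / Real.Gamma r / (1 + l) ^ (y i + r)) := by
  have := isProbabilityMeasure_gammaMeasure hr one_pos
  have hm : ∀ i, Measurable fun x : ℝ =>
    ENNReal.ofReal (x ^ y i * Real.exp (-(l * x))) := fun i => by fun_prop
  rw [lintegral_prod_eq_prod_lintegral_of_indepFun Finset.univ
    (fun i (g : Fin n → ℝ) => ENNReal.ofReal (g i ^ y i * Real.exp (-(l * g i))))
    (iIndepFun_pi (X := fun i (x : ℝ) => ENNReal.ofReal (x ^ y i * Real.exp (-(l * x))))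
      fun i => (hm i).aemeasurable) fun i => (hm i).comp (measurable_pi_apply i)]
  refine Finset.prod_congr rfl fun i _ => ?_
  rw [← lintegral_pow_mul_exp_gammaMeasure hr hl,
    ← lintegral_map (hm i) (measurable_pi_apply i)]
  congr 1
  exact (measurePreserving_eval (fun _ : Fin n => gammaMeasure r 1) i).map_eq

/-- The constant in the moments of the symmetric Dirichlet distribution. -/
noncomputable def dirichletMomentConst (r : ℝ) (n k : ℕ) : ENNReal :=
  ∫⁻ l : ℝ, (if 0 ≤ l then ENNReal.ofReal (l ^ ((k : ℝ) - 1) / Real.Gamma k) else 0) *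
    ENNReal.ofReal (((1 + l) ^ (k + n * r))⁻¹)

/-- The moments of the symmetric Dirichlet distribution, up to a constant that depends on the
degree only. The normalisation `S ^ (-k)`, `S = ∑ gᵢ`, is removed by writing it as the integral of
`λ ^ (k - 1) exp (-λ S) / Γ(k)`, whose integrand factorises over the independent `gᵢ`. -/
theorem lintegral_prod_pow_symmDirichletMeasure {r : ℝ} (hr : 0 < r) {n k : ℕ} (hn : 0 < n)
    (hk : 0 < k) (y : Fin n → ℕ) (hy : ∑ i, y i = k) :
    ∫⁻ θ, ENNReal.ofReal (∏ i, θ i ^ y i) ∂symmDirichletMeasure n r =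
      dirichletMomentConst r n k *
        ENNReal.ofReal (∏ i, (Real.Gamma (y i + r) / Real.Gamma r)) := by
  have hprob := isProbabilityMeasure_gammaMeasure hr one_pos
  have hkR : (0 : ℝ) < k := Nat.cast_pos.2 hk
  have hGk := Real.Gamma_pos_of_pos hkR
  have : Nonempty (Fin n) := ⟨⟨0, hn⟩⟩
  let h : ℝ → ENNReal := fun l =>
    if 0 ≤ l then ENNReal.ofReal (l ^ ((k : ℝ) - 1) / Real.Gamma k) else 0
  have hh : Measurable h := Measurable.ite measurableSet_Ici (by fun_prop) measurable_const
  rw [symmDirichletMeasure, lintegral_map (by fun_prop) (by fun_prop)]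
  have key : ∀ᵐ g ∂(Measure.pi fun _ : Fin n => gammaMeasure r 1),
      ENNReal.ofReal (∏ i, (g i / ∑ j, g j) ^ y i) =
        ∫⁻ l : ℝ, h l * ∏ i, ENNReal.ofReal (g i ^ y i * Real.exp (-(l * g i))) := by
    filter_upwards [ae_pi_gammaMeasure_pos hr n] with g hg
    have hS : 0 < ∑ j, g j := Finset.sum_pos (fun i _ => hg i) Finset.univ_nonempty
    have hP : 0 < ∏ i, g i ^ y i := Finset.prod_pos fun i _ => pow_pos (hg i) _
    simp_rw [div_pow]
    rw [Finset.prod_div_distrib, Finset.prod_pow_eq_pow_sum, hy,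
      ← mul_one (ENNReal.ofReal _), ← lintegral_gammaPDF_eq_one hkR hS,
      ← lintegral_const_mul _ (measurable_gammaPDF _ _)]
    refine lintegral_congr fun l => ?_
    by_cases hl : 0 ≤ l
    · have hl' := Real.rpow_nonneg hl ((k : ℝ) - 1)
      simp only [h, if_pos hl]
      rw [gammaPDF_of_nonneg hl, ← ENNReal.ofReal_mul (by positivity),
        ← ENNReal.ofReal_prod_of_nonneg (fun i _ => by have := hg i; positivity),
        ← ENNReal.ofReal_mul (by positivity), Finset.prod_mul_distrib, ← Real.exp_sum,
        Finset.sum_neg_distrib, ← Finset.mul_sum, Real.rpow_natCast, mul_comm l (∑ i, g i)]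
      congr 1
      field_simp
    · simp only [h, if_neg hl]
      rw [gammaPDF_of_neg (not_le.1 hl)]
      simp
  rw [lintegral_congr_ae key, lintegral_lintegral_swap (by fun_prop), dirichletMomentConst,
    ← lintegral_mul_const' _ _ ENNReal.ofReal_ne_top]
  refine lintegral_congr fun l => ?_
  rw [lintegral_const_mul _ (by fun_prop)]
  by_cases hl : 0 ≤ l
  · have hl1 : 0 < 1 + l := by positivity
    have hG := Real.Gamma_pos_of_pos hr
    have hG' : ∀ i, 0 < Real.Gamma (y i + r) := fun i => Real.Gamma_pos_of_pos (by positivity)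
    rw [lintegral_prod_pow_mul_exp_pi_gammaMeasure hr hl, mul_assoc,
      ← ENNReal.ofReal_mul (by positivity),
      ← ENNReal.ofReal_prod_of_nonneg (fun i _ => by have := hG' i; positivity),
      Finset.prod_div_distrib (g := fun i => (1 + l) ^ ((y i : ℝ) + r)),
      ← Real.rpow_sum_of_pos hl1, Finset.sum_add_distrib, ← Nat.cast_sum, hy]
    simp only [Finset.sum_const, Finset.card_univ, Fintype.card_fin, nsmul_eq_mul]
    rw [div_eq_inv_mul]
  · simp [h, hl]

/-- The integrated weight of a placement `y` of `k` balls is proportional to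
`∏ᵢ Γ(yᵢ + r) / (yᵢ! Γ(r))`: the factorials come from the multinomial coefficient. -/
theorem lintegral_multinomial_symmDirichletMeasure {r : ℝ} (hr : 0 < r) {n k : ℕ} (hn : 0 < n)
    (hk : 0 < k) (y : Fin n → ℕ) (hy : ∑ i, y i = k) :
    ∫⁻ θ, ENNReal.ofReal (Nat.multinomial Finset.univ y * ∏ i, θ i ^ y i)
        ∂symmDirichletMeasure n r =
      dirichletMomentConst r n k * k.factorial *
        ENNReal.ofReal (∏ i, negBinomialCoeff r (y i)) := by
  have hG := Real.Gamma_pos_of_pos hr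
  have hspec : ((∏ i, (y i).factorial : ℕ) : ℝ) * Nat.multinomial Finset.univ y = k.factorial := by
    have := Nat.multinomial_spec Finset.univ y
    rw [hy] at this
    exact_mod_cast this
  have hfac : (0 : ℝ) < ((∏ i, (y i).factorial : ℕ) : ℝ) := by
    exact_mod_cast Finset.prod_pos fun i _ => Nat.factorial_pos _
  have e : (Nat.multinomial Finset.univ y : ℝ) * ∏ i, (Real.Gamma (y i + r) / Real.Gamma r) =
      k.factorial * ∏ i, negBinomialCoeff r (y i) := by
    rw [← hspec]
    simp only [negBinomialCoeff]
    rw [Nat.cast_prod, mul_comm (∏ i, ((y i).factorial : ℝ)), mul_assoc,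
      ← Finset.prod_mul_distrib]
    congr 1
    refine Finset.prod_congr rfl fun i _ => ?_
    have : ((y i).factorial : ℝ) ≠ 0 := by positivity
    field_simp
  simp_rw [ENNReal.ofReal_mul (Nat.cast_nonneg (Nat.multinomial Finset.univ y))]
  rw [lintegral_const_mul _ (by fun_prop), lintegral_prod_pow_symmDirichletMeasure hr hn hk y hy,
    mul_left_comm, ← ENNReal.ofReal_mul (by positivity), e, ENNReal.ofReal_mul (by positivity),
    ENNReal.ofReal_natCast, mul_assoc]

theorem dirichletMultinomialMeasure_apply {r : ℝ} (hr : 0 < r) {n k : ℕ} (hn : 0 < n)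
    (hk : 0 < k) (s : Set (Fin n → ℕ)) [DecidablePred (· ∈ s)] :
    dirichletMultinomialMeasure n k r s = dirichletMomentConst r n k * k.factorial *
      ENNReal.ofReal (∑ y ∈ (Finset.piAntidiag Finset.univ k).filter (· ∈ s),
        ∏ i, negBinomialCoeff r (y i)) := by
  have hs : MeasurableSet s := MeasurableSet.of_discrete
  have hmeas : ∀ y : Fin n → ℕ, Measurable fun θ : Fin n → ℝ =>
      ENNReal.ofReal (Nat.multinomial Finset.univ y * ∏ i, θ i ^ y i) := fun y => by fun_prop
  have hpos : ∀ y : Fin n → ℕ, 0 ≤ ∏ i, negBinomialCoeff r (y i) := fun y =>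
    Finset.prod_nonneg fun i _ => (negBinomialCoeff_pos hr _).le
  rw [dirichletMultinomialMeasure, Measure.bind_apply hs
    (measurable_multinomialMeasure k).aemeasurable]
  simp only [multinomialMeasure, Measure.finsetSum_apply, Measure.smul_apply, smul_eq_mul]
  rw [lintegral_finsetSum _ (fun y _ => (hmeas y).mul_const _), Finset.sum_filter,
    ENNReal.ofReal_sum_of_nonneg (fun y _ => by split_ifs; exacts [hpos y, le_rfl]),
    Finset.mul_sum]
  refine Finset.sum_congr rfl fun y hy => ?_
  rw [lintegral_mul_const _ (hmeas y),
    lintegral_multinomial_symmDirichletMeasure hr hn hk y (by simpa using hy),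
    Measure.dirac_apply' _ hs]
  by_cases h : y ∈ s <;> simp [h]

theorem dirichletMultinomialMeasure_univ {r : ℝ} (hr : 0 < r) {n : ℕ} (hn : 0 < n) (k : ℕ) :
    dirichletMultinomialMeasure n k r Set.univ = 1 := by
  have hprob := isProbabilityMeasure_gammaMeasure hr one_pos
  have : Nonempty (Fin n) := ⟨⟨0, hn⟩⟩
  have hmeas : Measurable fun (g : Fin n → ℝ) i => g i / ∑ j, g j := by fun_prop
  have hmeas' : Measurable fun θ : Fin n → ℝ => multinomialMeasure k θ Set.univ :=
    (Measure.measurable_coe MeasurableSet.univ).comp (measurable_multinomialMeasure k)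
  rw [dirichletMultinomialMeasure, Measure.bind_apply MeasurableSet.univ
    (measurable_multinomialMeasure k).aemeasurable, symmDirichletMeasure,
    lintegral_map hmeas' hmeas]
  have key : ∀ᵐ g ∂(Measure.pi fun _ : Fin n => gammaMeasure r 1),
      multinomialMeasure k (fun i => g i / ∑ j, g j) Set.univ = 1 := by
    filter_upwards [ae_pi_gammaMeasure_pos hr n] with g hg
    have hS : 0 < ∑ j, g j := Finset.sum_pos (fun i _ => hg i) Finset.univ_nonempty
    simp only [multinomialMeasure, Measure.finsetSum_apply, Measure.smul_apply, smul_eq_mul,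
      measure_univ, mul_one]
    rw [← ENNReal.ofReal_sum_of_nonneg (fun y _ => mul_nonneg (Nat.cast_nonneg _)
      (Finset.prod_nonneg fun i _ => pow_nonneg (div_nonneg (hg i).le hS.le) _)),
      ← Finset.sum_pow_eq_sum_piAntidiag, ← Finset.sum_div, div_self hS.ne', one_pow,
      ENNReal.ofReal_one]
  rw [lintegral_congr_ae key]
  simp

theorem dirichletMultinomialMeasure_maxCount_le {r : ℝ} (hr : 0 < r) {n k : ℕ} (hn : 0 < n)
    (hk : 0 < k) (m : ℕ) :
    (dirichletMultinomialMeasure n k r).real {y | (maxCount y : ℤ) ≤ m} = cappedProb r n m k := by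
  classical
  have hs : 0 < (n : ℝ) * r := by positivity
  have hW := negBinomialCoeff_pos hs k
  have htot := dirichletMultinomialMeasure_apply hr hn hk (Set.univ : Set (Fin n → ℕ))
  rw [dirichletMultinomialMeasure_univ hr hn] at htot
  simp only [Set.mem_univ, Finset.filter_true] at htot
  rw [← coeff_mk_pow_eq_sum_piAntidiag, coeff_mk_negBinomialCoeff_pow hr hn] at htot
  have hC : dirichletMomentConst r n k * k.factorial =
      (ENNReal.ofReal (negBinomialCoeff (n * r) k))⁻¹ :=
    ENNReal.eq_inv_of_mul_eq_one_left htot.symm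
  rw [Measure.real, dirichletMultinomialMeasure_apply hr hn hk, hC, cappedProb, cappedWeight,
    coeff_mk_pow_eq_sum_piAntidiag, ENNReal.toReal_mul, ENNReal.toReal_inv,
    ENNReal.toReal_ofReal hW.le, ENNReal.toReal_ofReal (Finset.sum_nonneg fun y _ =>
      Finset.prod_nonneg fun i _ => (negBinomialCoeff_pos hr _).le), div_eq_inv_mul,
    Finset.sum_filter]
  congr 1
  refine Finset.sum_congr rfl fun y _ => ?_
  have hmax : (y ∈ {y : Fin n → ℕ | (maxCount y : ℤ) ≤ m}) ↔ ∀ i, y i ≤ m := by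
    simp [maxCount, Finset.sup_le_iff]
  by_cases h : ∀ i, y i ≤ m
  · rw [if_pos (hmax.2 h)]
    exact Finset.prod_congr rfl fun i _ => by rw [if_pos (h i)]
  · rw [if_neg (hmax.not.2 h)]
    push Not at h
    obtain ⟨i, hi⟩ := h
    exact (Finset.prod_eq_zero (Finset.mem_univ i) (if_neg hi.not_ge)).symm

/-! ### Tails of the negative binomial distribution -/

theorem hasSum_negBinomialTail {r p : ℝ} (hr : 0 < r) (hp0 : 0 < p) (hp1 : p < 1) (t : ℤ) :
    HasSum (fun j : ℕ => if (j : ℤ) ≤ t then 0 else negBinomialWeight r p j)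
      (negBinomialTail r p t) := by
  have hw := negBinomialWeight_pos hr hp0 hp1
  have hs := hasSum_negBinomialWeight hr hp0 hp1
  have hs' : Summable fun j : ℕ => if (j : ℤ) ≤ t then negBinomialWeight r p j else 0 :=
    (hs.summable.indicator {j : ℕ | (j : ℤ) ≤ t}).congr fun j => by
      simp [Set.indicator_apply]
  have hreal : (negBinomialMeasure r p).real {j : ℕ | (j : ℤ) ≤ t} =
      ∑' j : ℕ, if (j : ℤ) ≤ t then negBinomialWeight r p j else 0 := by
    have hnn : ∀ j : ℕ, 0 ≤ if (j : ℤ) ≤ t then negBinomialWeight r p j else 0 := fun j => by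
      split_ifs
      exacts [(hw j).le, le_rfl]
    rw [Measure.real, negBinomialMeasure, Measure.sum_apply _ MeasurableSet.of_discrete,
      ← ENNReal.toReal_ofReal (tsum_nonneg hnn), ENNReal.ofReal_tsum_of_nonneg hnn hs']
    congr 1
    refine tsum_congr fun j => ?_
    rw [Measure.smul_apply, Measure.dirac_apply' _ MeasurableSet.of_discrete]
    by_cases hj : (j : ℤ) ≤ t
    · simp [hj, negBinomialWeight, negBinomialCoeff]
    · simp [hj]
  rw [negBinomialTail, hreal]
  refine (hs.sub hs'.hasSum).congr_fun fun j => ?_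
  split_ifs <;> simp

theorem hasSum_negBinomialTail_natCast {r p : ℝ} (hr : 0 < r) (hp0 : 0 < p) (hp1 : p < 1)
    (t : ℕ) :
    HasSum (fun i : ℕ => negBinomialWeight r p (t + 1 + i)) (negBinomialTail r p t) := by
  have h := (hasSum_nat_add_iff' (t + 1)).2 (hasSum_negBinomialTail hr hp0 hp1 t)
  rw [Finset.sum_eq_zero, sub_zero] at h
  · refine h.congr_fun fun i => ?_
    rw [if_neg (by push_cast; omega), add_comm]
  · intro i hi
    rw [Finset.mem_range] at hi
    rw [if_pos (by omega)]

theorem sum_range_negBinomialWeight {r p : ℝ} (hr : 0 < r) (hp0 : 0 < p) (hp1 : p < 1) (t : ℕ) :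
    ∑ j ∈ Finset.range (t + 1), negBinomialWeight r p j = 1 - negBinomialTail r p t := by
  have h := (hasSum_nat_add_iff' (t + 1)).2 (hasSum_negBinomialWeight hr hp0 hp1)
  have h' := hasSum_negBinomialTail_natCast hr hp0 hp1 t
  have e := h.unique (h'.congr_fun fun i => by rw [add_comm])
  linarith

theorem negBinomialTail_pos {r p : ℝ} (hr : 0 < r) (hp0 : 0 < p) (hp1 : p < 1) (t : ℤ) :
    0 < negBinomialTail r p t := by
  have hw := negBinomialWeight_pos hr hp0 hp1
  refine (hw (t + 1).toNat).trans_le ?_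
  have h := le_hasSum (hasSum_negBinomialTail hr hp0 hp1 t) (t + 1).toNat fun j _ => by
    split_ifs
    exacts [le_rfl, (hw j).le]
  rwa [if_neg (by omega)] at h

theorem antitone_negBinomialTail {r p : ℝ} (hr : 0 < r) (hp0 : 0 < p) (hp1 : p < 1) :
    Antitone (negBinomialTail r p) := by
  intro s t hst
  refine hasSum_le (fun j => ?_) (hasSum_negBinomialTail hr hp0 hp1 t)
    (hasSum_negBinomialTail hr hp0 hp1 s)
  have hw := (negBinomialWeight_pos hr hp0 hp1 j).le
  by_cases h1 : (j : ℤ) ≤ s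
  · simp [h1, h1.trans hst]
  · rw [if_neg h1]
    split_ifs
    exacts [hw, le_rfl]

theorem negBinomialTail_neg_one {r p : ℝ} (hr : 0 < r) (hp0 : 0 < p) (hp1 : p < 1) :
    negBinomialTail r p (-1) = 1 :=
  (hasSum_negBinomialTail hr hp0 hp1 (-1)).unique
    ((hasSum_negBinomialWeight hr hp0 hp1).congr_fun fun j => by rw [if_neg (by omega)])

theorem tendsto_negBinomialTail_atTop {r p : ℝ} (hr : 0 < r) (hp0 : 0 < p) (hp1 : p < 1) :
    Tendsto (fun t : ℕ => negBinomialTail r p t) atTop (𝓝 0) := by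
  have h := (hasSum_negBinomialWeight hr hp0 hp1).tendsto_sum_nat.comp (tendsto_add_atTop_nat 1)
  have h' := h.const_sub 1
  rw [sub_self] at h'
  refine h'.congr fun t => ?_
  rw [Function.comp_apply, sum_range_negBinomialWeight hr hp0 hp1]
  ring

theorem negBinomialCoeff_succ_eq {r : ℝ} (hr : 0 < r) (k : ℕ) :
    negBinomialCoeff r (k + 1) = (k + r) / (k + 1) * negBinomialCoeff r k := by
  have h := succ_mul_negBinomialCoeff_succ hr k
  have : (0 : ℝ) < k + 1 := by positivity
  field_simp
  linarith

theorem tendsto_negBinomialCoeff_add_div {r : ℝ} (hr : 0 < r) (i : ℕ) :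
    Tendsto (fun t => negBinomialCoeff r (t + i) / negBinomialCoeff r t) atTop (𝓝 1) := by
  induction i with
  | zero =>
    refine tendsto_const_nhds.congr fun t => ?_
    rw [add_zero, div_self (negBinomialCoeff_pos hr t).ne']
  | succ i ih =>
    have h1 : Tendsto (fun k : ℕ => ((k : ℝ) + r) / (k + 1)) atTop (𝓝 1) := by
      have h0 : Tendsto (fun k : ℕ => (r - 1) / ((k : ℝ) + 1)) atTop (𝓝 0) :=
        tendsto_const_nhds.div_atTop
          (tendsto_natCast_atTop_atTop.atTop_add tendsto_const_nhds)
      have := h0.const_add 1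
      rw [add_zero] at this
      refine this.congr fun k => ?_
      have : (0 : ℝ) < k + 1 := by positivity
      field_simp
      ring
    have h2 := (h1.comp (tendsto_add_atTop_nat i)).mul ih
    rw [one_mul] at h2
    refine h2.congr fun t => ?_
    rw [Function.comp_apply, ← add_assoc, negBinomialCoeff_succ_eq hr (t + i), mul_div_assoc]

/-- The coefficients grow at most as fast as those of an exponent `c ≥ 1`, `c ≥ r`, started
afresh. -/
theorem negBinomialCoeff_add_le {r c : ℝ} (hr : 0 < r) (hrc : r ≤ c) (hc : 1 ≤ c) (t i : ℕ) :
    negBinomialCoeff r (t + i) ≤ negBinomialCoeff r t * negBinomialCoeff c i := by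
  have hc0 : 0 < c := by linarith
  induction i with
  | zero => simp [negBinomialCoeff_zero hc0]
  | succ i ih =>
    rw [← add_assoc, negBinomialCoeff_succ_eq hr, negBinomialCoeff_succ_eq hc0]
    have h1 : (((t + i : ℕ) : ℝ) + r) / ((t + i : ℕ) + 1) ≤ (i + c) / (i + 1) := by
      push_cast
      rw [div_le_div_iff₀ (by positivity) (by positivity)]
      have ht : (0 : ℝ) ≤ t := t.cast_nonneg
      have hi : (0 : ℝ) ≤ i := i.cast_nonneg
      nlinarith [mul_nonneg ht (sub_nonneg.2 hc), mul_nonneg hi (sub_nonneg.2 hrc)]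
    have h2 := negBinomialCoeff_pos hr (t + i)
    calc _ ≤ ((i : ℝ) + c) / (i + 1) * (negBinomialCoeff r t * negBinomialCoeff c i) := by
          gcongr
      _ = _ := by ring

/-- The tail is asymptotically geometric relative to its leading weight, uniformly in the success
parameter near `p`. -/
theorem tendsto_negBinomialTail_div_weight {ι : Type*} {l : Filter ι} {r p : ℝ} (hr : 0 < r)
    (hp0 : 0 < p) (hp1 : p < 1) {t : ι → ℕ} {q : ι → ℝ} (ht : Tendsto t l atTop)
    (hq : Tendsto q l (𝓝 p)) :
    Tendsto (fun j => negBinomialTail r (q j) (t j) / negBinomialWeight r (q j) (t j + 1)) l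
      (𝓝 (1 / (1 - p))) := by
  obtain ⟨ρ, hpρ, hρ1⟩ := exists_between hp1
  have hρ0 : 0 < ρ := hp0.trans hpρ
  have hc : 0 < max r 1 := lt_max_of_lt_right one_pos
  have hev : ∀ᶠ j in l, 0 < q j ∧ q j < ρ :=
    (hq.eventually_const_lt hp0).and (hq.eventually_lt_const hpρ)
  have hlim : Tendsto (fun j => ∑' i : ℕ,
      negBinomialCoeff r (t j + 1 + i) / negBinomialCoeff r (t j + 1) * q j ^ i) l
      (𝓝 (∑' i : ℕ, p ^ i)) := by
    refine tendsto_tsum_of_dominated_convergence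
      (hasSum_negBinomialCoeff_mul_pow hc hρ0 hρ1).summable (fun i => ?_) ?_
    · have h := ((tendsto_negBinomialCoeff_add_div hr i).comp
        ((tendsto_add_atTop_nat 1).comp ht)).mul (hq.pow i)
      rwa [one_mul] at h
    · filter_upwards [hev] with j hj i
      have h1 := negBinomialCoeff_pos hr (t j + 1)
      have h2 := negBinomialCoeff_pos hr (t j + 1 + i)
      have hq0 := hj.1
      have h3 := negBinomialCoeff_pos hc i
      rw [Real.norm_of_nonneg (by positivity)]
      refine mul_le_mul ?_ (pow_le_pow_left₀ hq0.le hj.2.le i) (by positivity) h3.le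
      rw [div_le_iff₀ h1, mul_comm]
      exact negBinomialCoeff_add_le hr (le_max_left _ _) (le_max_right _ _) _ _
  rw [tsum_geometric_of_lt_one hp0.le hp1, ← one_div] at hlim
  refine hlim.congr' ?_
  filter_upwards [hev] with j hj
  have hq1 := hj.2.trans hρ1
  have h := (hasSum_negBinomialTail_natCast hr hj.1 hq1 (t j)).div_const
    (negBinomialWeight r (q j) (t j + 1))
  rw [← h.tsum_eq]
  refine tsum_congr fun i => ?_
  have h1 := (negBinomialCoeff_pos hr (t j + 1)).ne'
  have h2 := (Real.rpow_pos_of_pos (sub_pos.2 hq1) r).ne'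
  have h3 := hj.1.ne'
  simp only [negBinomialWeight]
  rw [pow_add (q j) (t j + 1) i]
  field_simp

theorem tendsto_negBinomialTail_succ_div {r p : ℝ} (hr : 0 < r) (hp0 : 0 < p) (hp1 : p < 1) :
    Tendsto (fun t : ℕ => negBinomialTail r p (t + 1) / negBinomialTail r p t) atTop (𝓝 p) := by
  have h1 := tendsto_negBinomialTail_div_weight hr hp0 hp1 tendsto_id
    (tendsto_const_nhds (x := p))
  have h2 := h1.comp (tendsto_add_atTop_nat 1)
  have h3 := ((tendsto_negBinomialCoeff_add_div hr 1).comp (tendsto_add_atTop_nat 1)).mul_const p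
  have hne : 1 / (1 - p) ≠ 0 := by have := sub_pos.2 hp1; positivity
  have h := (h2.div h1 hne).mul h3
  rw [div_self hne, one_mul, one_mul] at h
  refine h.congr fun t => ?_
  have h4 := (negBinomialTail_pos hr hp0 hp1 t).ne'
  have h5 := (negBinomialTail_pos hr hp0 hp1 (t + 1)).ne'
  have h6 := (negBinomialCoeff_pos hr (t + 1)).ne'
  have h7 := (negBinomialCoeff_pos hr (t + 1 + 1)).ne'
  have h8 := (Real.rpow_pos_of_pos (sub_pos.2 hp1) r).ne'
  simp only [Function.comp_apply, id, negBinomialWeight, Pi.div_apply, Nat.cast_add, Nat.cast_one]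
  rw [pow_succ p (t + 1)]
  field_simp

/-- The tail does not notice a perturbation of the success parameter that is small compared with
`1 / t`. -/
theorem tendsto_negBinomialTail_div_negBinomialTail {ι : Type*} {l : Filter ι} {r p : ℝ}
    (hr : 0 < r) (hp0 : 0 < p) (hp1 : p < 1) {t : ι → ℕ} {q : ι → ℝ} (ht : Tendsto t l atTop)
    (hq : Tendsto q l (𝓝 p)) (hqt : Tendsto (fun j => (t j : ℝ) * (q j - p)) l (𝓝 0)) :
    Tendsto (fun j => negBinomialTail r (q j) (t j) / negBinomialTail r p (t j)) l (𝓝 1) := by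
  have h1p := sub_pos.2 hp1
  have hne : 1 / (1 - p) ≠ 0 := by positivity
  have h1 := (tendsto_negBinomialTail_div_weight hr hp0 hp1 ht hq).div
    (tendsto_negBinomialTail_div_weight hr hp0 hp1 ht (tendsto_const_nhds (x := p))) hne
  rw [div_self hne] at h1
  have hev : ∀ᶠ j in l, 0 < q j ∧ q j < 1 :=
    (hq.eventually_const_lt hp0).and (hq.eventually_lt_const hp1)
  have hqt1 : Tendsto (fun j => ((t j + 1 : ℕ) : ℝ) * (q j - p)) l (𝓝 0) := by
    have := hqt.add (hq.sub_const p)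
    rw [sub_self, add_zero] at this
    refine this.congr fun j => ?_
    push_cast; ring
  -- `(q / p) ^ (t + 1) → 1`, by `1 - 1 / x ≤ log x ≤ x - 1`
  have hlog : Tendsto (fun j => ((t j + 1 : ℕ) : ℝ) * Real.log (q j / p)) l (𝓝 0) := by
    have hl := hqt1.div hq hp0.ne'
    have hu := hqt1.div_const p
    rw [zero_div] at hl hu
    refine tendsto_of_tendsto_of_tendsto_of_le_of_le' hl hu ?_ ?_
    · filter_upwards [hev] with j hj
      have hq0 := hj.1
      have := Real.one_sub_inv_le_log_of_pos (show 0 < q j / p by positivity)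
      rw [Pi.div_apply, mul_div_assoc]
      refine mul_le_mul_of_nonneg_left (le_trans (le_of_eq ?_) this) (Nat.cast_nonneg _)
      field_simp
    · filter_upwards [hev] with j hj
      have hq0 := hj.1
      have := Real.log_le_sub_one_of_pos (show 0 < q j / p by positivity)
      rw [mul_div_assoc]
      refine mul_le_mul_of_nonneg_left (this.trans (le_of_eq ?_)) (Nat.cast_nonneg _)
      field_simp
  have hpow : Tendsto (fun j => (q j / p) ^ (t j + 1)) l (𝓝 1) := by
    have := (Real.continuous_exp.tendsto 0).comp hlog
    rw [Real.exp_zero] at this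
    refine this.congr' ?_
    filter_upwards [hev] with j hj
    have hq0 := hj.1
    rw [Function.comp_apply, Real.exp_nat_mul, Real.exp_log (by positivity)]
  have hlast : Tendsto (fun j => (1 - q j) ^ r / (1 - p) ^ r) l (𝓝 1) := by
    have := ((hq.const_sub 1).rpow_const (Or.inl h1p.ne') (p := r)).div_const ((1 - p) ^ r)
    rwa [div_self (Real.rpow_pos_of_pos h1p r).ne'] at this
  have h := (h1.mul hpow).mul hlast
  rw [one_mul, one_mul] at h
  refine h.congr' ?_
  filter_upwards [hev] with j hj
  have h2 := (negBinomialTail_pos hr hp0 hp1 (t j)).ne'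
  have h3 := (negBinomialCoeff_pos hr (t j + 1)).ne'
  have h4 := (Real.rpow_pos_of_pos h1p r).ne'
  have h5 := (Real.rpow_pos_of_pos (sub_pos.2 hj.2) r).ne'
  have h6 := hj.1.ne'
  simp only [Pi.div_apply, negBinomialWeight, div_pow]
  field_simp

theorem tendsto_int_negBinomialTail_succ_div {r p : ℝ} (hr : 0 < r) (hp0 : 0 < p) (hp1 : p < 1) :
    Tendsto (fun t : ℤ => negBinomialTail r p (t + 1) / negBinomialTail r p t) atTop (𝓝 p) := by
  have ht : Tendsto Int.toNat atTop atTop :=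
    tendsto_atTop_atTop.2 fun b => ⟨b, fun a ha => by omega⟩
  refine ((tendsto_negBinomialTail_succ_div hr hp0 hp1).comp ht).congr' ?_
  filter_upwards [eventually_ge_atTop 0] with t h0
  simp [Int.toNat_of_nonneg h0]

theorem tendsto_negBinomialTail_add_div {r p : ℝ} (hr : 0 < r) (hp0 : 0 < p) (hp1 : p < 1)
    (x : ℤ) :
    Tendsto (fun t : ℤ => negBinomialTail r p (t + x) / negBinomialTail r p t) atTop
      (𝓝 (p ^ x)) := by
  have hT := fun t => (negBinomialTail_pos hr hp0 hp1 t).ne'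
  have h1 := tendsto_int_negBinomialTail_succ_div hr hp0 hp1
  have hadd : ∀ y : ℤ, Tendsto (fun t : ℤ => t + y) atTop atTop := fun y =>
    tendsto_atTop_add_const_right _ _ tendsto_id
  induction x using Int.induction_on with
  | zero => simp [hT]
  | succ i ih =>
    have h := (h1.comp (hadd i)).mul ih
    rw [mul_comm, ← zpow_add_one₀ hp0.ne'] at h
    refine h.congr fun t => ?_
    rw [Function.comp_apply, add_assoc, div_mul_div_cancel₀ (hT _)]
  | pred i ih =>
    have h := ((h1.comp (hadd (-(i : ℤ) - 1))).inv₀ hp0.ne').mul ih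
    rw [mul_comm, ← zpow_sub_one₀ hp0.ne'] at h
    refine h.congr fun t => ?_
    have e : t + (-(i : ℤ) - 1) + 1 = t + -i := by ring
    simp only [Function.comp_apply, e, inv_div]
    rw [div_mul_div_cancel₀ (hT _)]

theorem tendsto_pow_four_mul_negBinomialTail {r p : ℝ} (hr : 0 < r) (hp0 : 0 < p) (hp1 : p < 1) :
    Tendsto (fun t : ℕ => (t : ℝ) ^ 4 * negBinomialTail r p t) atTop (𝓝 0) := by
  have hT := fun t => negBinomialTail_pos hr hp0 hp1 t
  refine Summable.tendsto_atTop_zero (summable_of_ratio_test_tendsto_lt_one hp1 ?_ ?_)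
  · filter_upwards [eventually_gt_atTop 0] with t ht
    have := hT t
    positivity
  · have h0 : Tendsto (fun t : ℕ => (1 + 1 / (t : ℝ)) ^ 4) atTop (𝓝 1) := by
      have := ((tendsto_one_div_atTop_nhds_zero_nat (𝕜 := ℝ)).const_add 1).pow 4
      simpa using this
    have h := h0.mul (tendsto_negBinomialTail_succ_div hr hp0 hp1)
    rw [one_mul] at h
    refine h.congr' ?_
    filter_upwards [eventually_gt_atTop 0] with t ht
    have h1 := hT t
    have h2 := hT (t + 1)
    have ht' : (0 : ℝ) < t := Nat.cast_pos.2 ht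
    push_cast
    rw [Real.norm_of_nonneg (by positivity), Real.norm_of_nonneg (by positivity)]
    field_simp

/-! ### Continuous extensions of the tail -/

/-- Replacing the indicator of `j > t` by the ramp `min 1 (max 0 (j - t))` in the tail sum gives a
continuous extension. -/
theorem exists_isTailExtension_negBinomialTail {r p : ℝ} (hr : 0 < r) (hp0 : 0 < p)
    (hp1 : p < 1) : ∃ G : ℝ → ℝ, IsTailExtension (negBinomialTail r p) G := by
  have hw := fun j => (negBinomialWeight_pos hr hp0 hp1 j).le
  have hs := (hasSum_negBinomialWeight hr hp0 hp1).summable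
  let f : ℕ → ℝ → ℝ := fun j t => negBinomialWeight r p j * min 1 (max 0 ((j : ℝ) - t))
  have hf0 : ∀ j t, 0 ≤ f j t := fun j t =>
    mul_nonneg (hw j) (le_min zero_le_one (le_max_left _ _))
  have hf1 : ∀ j t, f j t ≤ negBinomialWeight r p j := fun j t =>
    mul_le_of_le_one_right (hw j) (min_le_left _ _)
  have hf : ∀ j t, ‖f j t‖ ≤ negBinomialWeight r p j := fun j t => by
    rw [Real.norm_of_nonneg (hf0 j t)]; exact hf1 j t
  have hsum : ∀ t, Summable fun j => f j t := fun t => hs.of_norm_bounded fun j => hf j t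
  refine ⟨fun t => ∑' j, f j t, fun t => ?_, continuous_tsum (fun j => by fun_prop) hs hf, ?_⟩
  · rw [← (hasSum_negBinomialTail hr hp0 hp1 t).tsum_eq]
    refine tsum_congr fun j => ?_
    simp only [f]
    split_ifs with hj
    · have : (j : ℝ) ≤ t := by exact_mod_cast hj
      rw [max_eq_left (by linarith), min_eq_right zero_le_one, mul_zero]
    · have : (t : ℝ) + 1 ≤ j := by exact_mod_cast not_le.1 hj
      rw [max_eq_right (by linarith), min_eq_left (by linarith), mul_one]
  · intro s t hst
    refine (hsum t).tsum_le_tsum (fun j => ?_) (hsum s)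
    exact mul_le_mul_of_nonneg_left (min_le_min_left _ (max_le_max_left _ (by linarith))) (hw j)

theorem IsTailExtension.exists_isQuantileSeq {r p : ℝ} (hr : 0 < r) (hp0 : 0 < p)
    (hp1 : p < 1) {G : ℝ → ℝ} (hG : IsTailExtension (negBinomialTail r p) G) :
    ∃ ξ : ℕ → ℝ, IsQuantileSeq G ξ := by
  have key : ∀ n : ℕ, ∃ x : ℝ, 1 ≤ n → G x = 1 / n := by
    intro n
    rcases Nat.eq_zero_or_pos n with rfl | hn
    · exact ⟨0, fun h => absurd h (by norm_num)⟩
    have hn' : (0 : ℝ) < n := Nat.cast_pos.2 hn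
    obtain ⟨t, ht⟩ := ((tendsto_negBinomialTail_atTop hr hp0 hp1).eventually_lt_const
      (show 0 < 1 / (n : ℝ) by positivity)).exists
    have h1 : G (-1) = 1 := by
      have := hG.eq_tail (-1)
      rw [negBinomialTail_neg_one hr hp0 hp1] at this
      exact_mod_cast this
    have h2 : G t = negBinomialTail r p t := by exact_mod_cast hG.eq_tail t
    have hle : (-1 : ℝ) ≤ t := by linarith [(Nat.cast_nonneg t : (0 : ℝ) ≤ t)]
    obtain ⟨x, -, hx⟩ := intermediate_value_Icc' hle hG.continuous.continuousOn
      (show 1 / (n : ℝ) ∈ Set.Icc (G t) (G (-1)) from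
        ⟨by rw [h2]; exact ht.le, by
          rw [h1, div_le_one hn']; exact_mod_cast hn⟩)
    exact ⟨x, fun _ => hx⟩
  choose ξ hξ using key
  exact ⟨ξ, hξ⟩

theorem IsTailExtension.tendsto_centering {r p : ℝ} (hr : 0 < r) (hp0 : 0 < p) (hp1 : p < 1)
    {G : ℝ → ℝ} (hG : IsTailExtension (negBinomialTail r p) G) {ξ : ℕ → ℝ}
    (hξ : IsQuantileSeq G ξ) : Tendsto (centering ξ) atTop atTop := by
  refine tendsto_atTop.2 fun b => ?_
  filter_upwards [eventually_ge_atTop 1, (tendsto_one_div_atTop_nhds_zero_nat (𝕜 := ℝ)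
    ).eventually_lt_const (negBinomialTail_pos hr hp0 hp1 b)] with n hn1 hn
  by_contra hlt
  have h1 : centering ξ n + 1 ≤ b := by omega
  have h2 : ξ n ≤ ((centering ξ n + 1 : ℤ) : ℝ) := by
    have := Int.lt_floor_add_one (ξ n + 1 / 2)
    rw [centering]; push_cast; linarith
  have h3 := hG.antitone h2
  rw [hξ n hn1, hG.eq_tail] at h3
  exact absurd (antitone_negBinomialTail hr hp0 hp1 h1) (by linarith)

/-- The expected number `n P(X > m_n)` of counts above the centering lies between two consecutive
tail ratios, because `m_n - 1 ≤ ξ_n ≤ m_n + 1`. -/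
theorem IsTailExtension.natCast_mul_tail_centering_bounds {r p : ℝ} (hr : 0 < r) (hp0 : 0 < p)
    (hp1 : p < 1) {G : ℝ → ℝ} (hG : IsTailExtension (negBinomialTail r p) G) {ξ : ℕ → ℝ}
    (hξ : IsQuantileSeq G ξ) {n : ℕ} (hn : 1 ≤ n) :
    negBinomialTail r p (centering ξ n) / negBinomialTail r p (centering ξ n + -1) ≤
        n * negBinomialTail r p (centering ξ n) ∧
      n * negBinomialTail r p (centering ξ n) ≤
        negBinomialTail r p (centering ξ n) / negBinomialTail r p (centering ξ n + 1) := by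
  have hT := negBinomialTail_pos hr hp0 hp1
  have hn' : (0 : ℝ) < n := Nat.cast_pos.2 hn
  have h1 : ξ n ≤ ((centering ξ n + 1 : ℤ) : ℝ) := by
    have := Int.lt_floor_add_one (ξ n + 1 / 2)
    rw [centering]; push_cast; linarith
  have h2 : ((centering ξ n + -1 : ℤ) : ℝ) ≤ ξ n := by
    have := Int.floor_le (ξ n + 1 / 2)
    rw [centering]; push_cast; linarith
  have h3 := hG.antitone h1
  have h4 := hG.antitone h2
  rw [hξ n hn, hG.eq_tail] at h3 h4
  rw [le_div_iff₀ hn'] at h3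
  rw [div_le_iff₀ hn'] at h4
  constructor
  · rw [div_le_iff₀ (hT _)]
    nlinarith [hT (centering ξ n)]
  · rw [le_div_iff₀ (hT _)]
    nlinarith [hT (centering ξ n)]

/-! ### Removing the conditioning on the number of balls -/

/-- Chebyshev's inequality for the total of `n` independent `NB(r, q)` counts, for totals at least
as far from its mean as the mean `k = n r p / (1 - p)` of another success parameter `p`. -/
theorem tsum_indicator_negBinomialWeight_le_of_mean {r p q k : ℝ} (hr : 0 < r) (hp0 : 0 < p)
    (hp1 : p < 1) (hq0 : 0 < q) (hq1 : q < 1) (hpq : q ≠ p) {n : ℕ} (hn : 0 < n)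
    (hk : r * p / (1 - p) = k / n) {A : Set ℕ}
    (hA : ∀ i ∈ A, |k - n * r * q / (1 - q)| ≤ |(i : ℝ) - n * r * q / (1 - q)|) :
    ∑' i, A.indicator (negBinomialWeight (n * r) q) i ≤ 1 / (n * r * (q - p) ^ 2) := by
  have hn' : (0 : ℝ) < n := Nat.cast_pos.2 hn
  have h1p := sub_pos.2 hp1
  have h1q := sub_pos.2 hq1
  have hpq' := sub_ne_zero.2 hpq
  have hkk : k - n * r * q / (1 - q) = n * r * (p - q) / ((1 - q) * (1 - p)) := by
    have h1 : k = r * p / (1 - p) * n := ((eq_div_iff hn'.ne').1 hk).symm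
    rw [h1]
    field_simp
    ring
  have hd : 0 < |k - n * r * q / (1 - q)| := by
    rw [abs_pos, hkk]
    have := sub_ne_zero.2 hpq.symm
    positivity
  refine (tsum_indicator_negBinomialWeight_le (by positivity) hq0 hq1 hd hA).trans ?_
  rw [sq_abs, hkk]
  have e : (n : ℝ) * r * q / (1 - q) ^ 2 / (n * r * (p - q) / ((1 - q) * (1 - p))) ^ 2 =
      q * (1 - p) ^ 2 * (1 / (n * r * (q - p) ^ 2)) := by
    have := sub_ne_zero.2 hpq.symm
    field_simp
    ring
  rw [e]
  refine mul_le_of_le_one_left (by positivity) ?_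
  exact mul_le_one₀ hq1.le (by positivity) (pow_le_one₀ h1p.le (by linarith))

/-- With a larger success parameter, few totals fall below `k`; above `k` the capped probability is
smaller than at `k`. -/
theorem one_sub_negBinomialTail_pow_le_cappedProb {r p q : ℝ} (hr : 0 < r) (hp0 : 0 < p)
    (hp1 : p < 1) (hq1 : q < 1) (hpq : p < q) {n k : ℕ} (hn : 0 < n)
    (hk : r * p / (1 - p) = (k : ℝ) / n) (m : ℕ) :
    (1 - negBinomialTail r q m) ^ n ≤ cappedProb r n m k + 1 / (n * r * (q - p) ^ 2) := by
  have hq0 := hp0.trans hpq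
  have hn' : (0 : ℝ) < n := Nat.cast_pos.2 hn
  have hs : 0 < (n : ℝ) * r := by positivity
  have hw := hasSum_negBinomialWeight hs hq0 hq1
  have hmix := hasSum_negBinomialWeight_mul_cappedProb hr hq0 hq1 hn m
  rw [sum_range_negBinomialWeight hr hq0 hq1] at hmix
  have hmean : (k : ℝ) ≤ n * r * q / (1 - q) := by
    have h1 : (k : ℝ) = n * r * p / (1 - p) := by
      rw [eq_div_iff hn'.ne'] at hk; rw [← hk]; ring
    rw [h1]
    have := sub_pos.2 hq1
    exact div_le_div₀ (by positivity) (by gcongr) this (by linarith)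
  have hcheb := tsum_indicator_negBinomialWeight_le_of_mean hr hp0 hp1 hq0 hq1 hpq.ne' hn hk
    (A := {i | i < k}) (fun i hi => by
      have : (i : ℝ) ≤ k := Nat.cast_le.2 (le_of_lt hi)
      rw [abs_of_nonpos (by linarith), abs_of_nonpos (by linarith)]
      linarith)
  have hind := (hw.summable.indicator {i | i < k}).hasSum
  have h := hasSum_le (fun i => ?_) hmix ((hw.mul_left (cappedProb r n m k)).add hind)
  · rw [mul_one] at h
    linarith
  · have hwi := (negBinomialWeight_pos hs hq0 hq1 i).le
    have hc0 := cappedProb_nonneg hr hn m k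
    by_cases hi : i < k
    · rw [Set.indicator_of_mem (show i ∈ {i | i < k} from hi)]
      have := mul_le_of_le_one_right hwi (cappedProb_le_one hr hn m i)
      have := mul_nonneg hc0 hwi
      linarith
    · rw [Set.indicator_of_notMem (show i ∉ {i | i < k} from hi), add_zero, mul_comm]
      exact mul_le_mul_of_nonneg_right (antitone_cappedProb hr hn m (not_lt.1 hi)) hwi

/-- With a smaller success parameter, few totals exceed `k`; up to `k` the capped probability is
larger than at `k`. -/
theorem cappedProb_le_one_sub_negBinomialTail_pow {r p q : ℝ} (hr : 0 < r) (hp1 : p < 1)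
    (hq0 : 0 < q) (hqp : q < p) {n k : ℕ} (hn : 0 < n)
    (hk : r * p / (1 - p) = (k : ℝ) / n) (m : ℕ) :
    cappedProb r n m k ≤ (1 - negBinomialTail r q m) ^ n + 1 / (n * r * (q - p) ^ 2) := by
  have hq1 := hqp.trans hp1
  have hp0 := hq0.trans hqp
  have hn' : (0 : ℝ) < n := Nat.cast_pos.2 hn
  have hs : 0 < (n : ℝ) * r := by positivity
  have hw := hasSum_negBinomialWeight hs hq0 hq1
  have hmix := hasSum_negBinomialWeight_mul_cappedProb hr hq0 hq1 hn m
  rw [sum_range_negBinomialWeight hr hq0 hq1] at hmix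
  have hmean : n * r * q / (1 - q) ≤ k := by
    have h1 : (k : ℝ) = n * r * p / (1 - p) := by
      rw [eq_div_iff hn'.ne'] at hk; rw [← hk]; ring
    rw [h1]
    have := sub_pos.2 hp1
    exact div_le_div₀ (by positivity) (by gcongr) this (by linarith)
  have hcheb := tsum_indicator_negBinomialWeight_le_of_mean hr hp0 hp1 hq0 hq1 hqp.ne hn hk
    (A := {i | k < i}) (fun i hi => by
      have : (k : ℝ) ≤ i := Nat.cast_le.2 (le_of_lt hi)
      rw [abs_of_nonneg (by linarith), abs_of_nonneg (by linarith)]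
      linarith)
  have hind := (hw.summable.indicator {i | k < i}).hasSum
  have h := hasSum_le (fun i => ?_) (hw.mul_left (cappedProb r n m k)) (hmix.add hind)
  · rw [mul_one] at h
    linarith
  · have hwi := (negBinomialWeight_pos hs hq0 hq1 i).le
    have hc0 := cappedProb_nonneg hr hn m i
    by_cases hi : k < i
    · rw [Set.indicator_of_mem (show i ∈ {i | k < i} from hi)]
      have := mul_le_of_le_one_left hwi (cappedProb_le_one hr hn m k)
      have := mul_nonneg hwi hc0
      linarith
    · rw [Set.indicator_of_notMem (show i ∉ {i | k < i} from hi), add_zero, mul_comm]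
      exact mul_le_mul_of_nonneg_left (antitone_cappedProb hr hn m (not_lt.1 hi)) hwi

/-! ### The Poisson approximation of the maximum -/

theorem Asymptotics.IsBigO.tendsto_mul_zero {ι : Type*} {l : Filter ι} {a e : ι → ℝ}
    (ha : a =O[l] fun _ => (1 : ℝ)) (he : Tendsto e l (𝓝 0)) :
    Tendsto (fun j => a j * e j) l (𝓝 0) := by
  have h := ha.mul_isLittleO ((isLittleO_one_iff ℝ).2 he)
  simp only [mul_one] at h
  exact (isLittleO_one_iff ℝ).1 h

/-- `(1 - a) ^ n ~ exp (-c)` when `n a - c → 0` with `c` bounded. -/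
theorem tendsto_one_sub_pow_mul_exp {ι : Type*} {l : Filter ι} {N : ι → ℕ} {a c : ι → ℝ}
    (hN : Tendsto N l atTop) (hc : c =O[l] fun _ => (1 : ℝ))
    (ha : Tendsto (fun j => N j * a j - c j) l (𝓝 0)) :
    Tendsto (fun j => (1 - a j) ^ N j * Real.exp (c j)) l (𝓝 1) := by
  have hNa : (fun j => N j * a j) =O[l] fun _ => (1 : ℝ) := by
    simpa using (ha.isBigO_one ℝ).add hc
  have ha0 : Tendsto a l (𝓝 0) := by
    have hinv : Tendsto (fun j => ((N j : ℝ))⁻¹) l (𝓝 0) :=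
      tendsto_inv_atTop_zero.comp (tendsto_natCast_atTop_atTop.comp hN)
    refine (hNa.tendsto_mul_zero hinv).congr' ?_
    filter_upwards [hN.eventually_gt_atTop 0] with j hj
    have : (N j : ℝ) ≠ 0 := by positivity
    field_simp
  have hev : ∀ᶠ j in l, a j < 1 := ha0.eventually_lt_const one_pos
  have hlog : Tendsto (fun j => N j * Real.log (1 - a j) + c j) l (𝓝 0) := by
    have hu : Tendsto (fun j => -(N j * a j - c j)) l (𝓝 0) := by simpa using ha.neg
    have hl : Tendsto (fun j => -(N j * a j - c j) - N j * a j * (a j / (1 - a j))) l (𝓝 0) := by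
      have h1 : Tendsto (fun j => a j / (1 - a j)) l (𝓝 0) := by
        have h := ha0.div (ha0.const_sub 1) (by simp)
        rwa [zero_div] at h
      simpa using hu.sub (hNa.tendsto_mul_zero h1)
    refine tendsto_of_tendsto_of_tendsto_of_le_of_le' hl hu ?_ ?_
    · filter_upwards [hev] with j hj
      have h1 := sub_pos.2 hj
      have := mul_le_mul_of_nonneg_left (Real.one_sub_inv_le_log_of_pos h1)
        (Nat.cast_nonneg (N j))
      have e : (N j : ℝ) * (1 - (1 - a j)⁻¹) = -(N j * a j) - N j * a j * (a j / (1 - a j)) := by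
        field_simp
        ring
      linarith
    · filter_upwards [hev] with j hj
      have := mul_le_mul_of_nonneg_left (Real.log_le_sub_one_of_pos (sub_pos.2 hj))
        (Nat.cast_nonneg (N j))
      linarith
  have h := (Real.continuous_exp.tendsto 0).comp hlog
  rw [Real.exp_zero] at h
  refine h.congr' ?_
  filter_upwards [hev] with j hj
  rw [Function.comp_apply, Real.exp_add, Real.exp_nat_mul, Real.exp_log (sub_pos.2 hj)]

/-- The maximal count stays below `t` with probability asymptotic to `exp (-c)`, where `c` is the
expected number of independent `NB(r, p)` counts above `t`. -/
theorem tendsto_cappedProb_mul_exp {r p : ℝ} (hr : 0 < r) (hp0 : 0 < p) (hp1 : p < 1) {ι : Type*}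
    {l : Filter ι} {N K t : ι → ℕ} {c : ι → ℝ} (hN : Tendsto N l atTop)
    (hK : ∀ j, r * p / (1 - p) = (K j : ℝ) / N j) (ht : Tendsto t l atTop)
    (htN : Tendsto (fun j => (t j : ℝ) ^ 4 / N j) l (𝓝 0)) (hc : c =O[l] fun _ => (1 : ℝ))
    (htail : Tendsto (fun j => N j * negBinomialTail r p (t j) - c j) l (𝓝 0)) :
    Tendsto (fun j => cappedProb r (N j) (t j) (K j) * Real.exp (c j)) l (𝓝 1) := by
  have htR : Tendsto (fun j => (t j : ℝ)) l atTop := tendsto_natCast_atTop_atTop.comp ht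
  have hinv : Tendsto (fun j => ((t j : ℝ))⁻¹) l (𝓝 0) := tendsto_inv_atTop_zero.comp htR
  have hNT : (fun j => N j * negBinomialTail r p (t j)) =O[l] fun _ => (1 : ℝ) := by
    simpa using (htail.isBigO_one ℝ).add hc
  have hexp : (fun j => Real.exp (c j)) =O[l] fun _ => (1 : ℝ) := by
    obtain ⟨C, hC⟩ := hc.bound
    refine IsBigO.of_bound (Real.exp C) ?_
    filter_upwards [hC] with j hj
    rw [norm_one, mul_one] at hj ⊢
    rw [Real.norm_of_nonneg (Real.exp_pos _).le]
    exact Real.exp_le_exp.2 ((le_abs_self _).trans hj)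
  -- success parameters `p ± 1 / t ^ 2`: the shift is small compared with `1 / t`, so that it does
  -- not affect the tail, and large compared with `1 / √n`, so that Chebyshev's inequality applies
  have main : ∀ σ : ℝ, Tendsto (fun j => (1 - negBinomialTail r (p + σ * ((t j : ℝ))⁻¹ ^ 2) (t j))
      ^ N j * Real.exp (c j)) l (𝓝 1) := by
    intro σ
    have hq : Tendsto (fun j => p + σ * ((t j : ℝ))⁻¹ ^ 2) l (𝓝 p) := by
      simpa using ((hinv.pow 2).const_mul σ).const_add p
    have hqt : Tendsto (fun j => (t j : ℝ) * (p + σ * ((t j : ℝ))⁻¹ ^ 2 - p)) l (𝓝 0) := by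
      have h := hinv.const_mul σ
      rw [mul_zero] at h
      refine h.congr' ?_
      filter_upwards [htR.eventually_gt_atTop 0] with j hj
      field_simp
      ring
    refine tendsto_one_sub_pow_mul_exp hN hc ?_
    have h1 := (tendsto_negBinomialTail_div_negBinomialTail hr hp0 hp1 ht hq hqt).sub_const 1
    rw [sub_self] at h1
    have h2 := (hNT.tendsto_mul_zero h1).add htail
    rw [add_zero] at h2
    refine h2.congr fun j => ?_
    have := (negBinomialTail_pos hr hp0 hp1 (t j)).ne'
    field_simp
    ring
  have herr : Tendsto (fun j => (t j : ℝ) ^ 4 / N j / r * Real.exp (c j)) l (𝓝 0) := by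
    have h := htN.div_const r
    rw [zero_div] at h
    exact (hexp.tendsto_mul_zero h).congr fun j => mul_comm _ _
  have hl := (main 1).sub herr
  have hu := (main (-1)).add herr
  rw [sub_zero] at hl
  rw [add_zero] at hu
  have hsq : Tendsto (fun j => ((t j : ℝ))⁻¹ ^ 2) l (𝓝 0) := by simpa using hinv.pow 2
  have herr_eq : ∀ j, 0 < (t j : ℝ) → 0 < N j → ∀ σ : ℝ, σ ^ 2 = 1 →
      1 / (N j * r * (p + σ * ((t j : ℝ))⁻¹ ^ 2 - p) ^ 2) = (t j : ℝ) ^ 4 / N j / r := by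
    intro j h1 h2 σ hσ
    have : (0 : ℝ) < N j := Nat.cast_pos.2 h2
    rw [add_sub_cancel_left, mul_pow, hσ]
    field_simp
  refine tendsto_of_tendsto_of_tendsto_of_le_of_le' hl hu ?_ ?_
  · filter_upwards [htR.eventually_gt_atTop 0, hN.eventually_gt_atTop 0,
      hsq.eventually_lt_const (sub_pos.2 hp1)] with j h1 h2 h3
    have h4 : 0 < ((t j : ℝ))⁻¹ ^ 2 := by positivity
    have h := one_sub_negBinomialTail_pow_le_cappedProb hr hp0 hp1
      (q := p + 1 * ((t j : ℝ))⁻¹ ^ 2) (by linarith) (by linarith) h2 (hK j) (t j)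
    rw [herr_eq j h1 h2 1 (by norm_num)] at h
    have := mul_le_mul_of_nonneg_right h (Real.exp_pos (c j)).le
    linarith
  · filter_upwards [htR.eventually_gt_atTop 0, hN.eventually_gt_atTop 0,
      hsq.eventually_lt_const hp0] with j h1 h2 h3
    have h4 : 0 < ((t j : ℝ))⁻¹ ^ 2 := by positivity
    have h := cappedProb_le_one_sub_negBinomialTail_pow hr hp1
      (q := p + -1 * ((t j : ℝ))⁻¹ ^ 2) (by linarith) (by linarith) h2 (hK j) (t j)
    rw [herr_eq j h1 h2 (-1) (by norm_num)] at h
    have := mul_le_mul_of_nonneg_right h (Real.exp_pos (c j)).le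
    linarith

theorem theorem6 (r p : ℝ) (hr : 0 < r) (hp0 : 0 < p) (hp1 : p < 1) :
    -- the ratio of consecutive tails of `NB(r, p)` tends to `γ = p`
    Tendsto (fun t : ℕ => negBinomialTail r p (t + 1) / negBinomialTail r p t) atTop (𝓝 p) ∧
    -- the quantities that define `m_n` and `p_n` exist
    (∃ G : ℝ → ℝ, IsTailExtension (negBinomialTail r p) G) ∧
    ∀ G : ℝ → ℝ, IsTailExtension (negBinomialTail r p) G →
      (∃ ξ : ℕ → ℝ, IsQuantileSeq G ξ) ∧
      ∀ ξ : ℕ → ℝ, IsQuantileSeq G ξ →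
        -- `n = N j` boxes and `k = K j` balls, `n → ∞` with `k / n` fixed
        ∀ N K : ℕ → ℕ, Tendsto N atTop atTop →
          (∀ j, r * p / (1 - p) = (K j : ℝ) / (N j : ℝ)) →
          ∀ x : ℤ,
            (fun j => (dirichletMultinomialMeasure (N j) (K j) r).real
                {y | (maxCount y : ℤ) ≤ centering ξ (N j) + x})
              ~[atTop] fun j => baseProb G ξ (N j) ^ (p ^ x : ℝ) := by
  refine ⟨tendsto_negBinomialTail_succ_div hr hp0 hp1,
    exists_isTailExtension_negBinomialTail hr hp0 hp1,
    fun G hG => ⟨hG.exists_isQuantileSeq hr hp0 hp1, fun ξ hξ N K hN hK x => ?_⟩⟩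
  have hT := negBinomialTail_pos hr hp0 hp1
  have hm : Tendsto (fun j => centering ξ (N j)) atTop atTop :=
    (hG.tendsto_centering hr hp0 hp1 hξ).comp hN
  have hmx : Tendsto (fun j => centering ξ (N j) + x) atTop atTop :=
    tendsto_atTop_add_const_right _ _ hm
  have ht : Tendsto (fun j => (centering ξ (N j) + x).toNat) atTop atTop :=
    (tendsto_atTop_atTop.2 fun b : ℕ => ⟨b, fun a ha => by omega⟩ :
      Tendsto Int.toNat atTop atTop).comp hmx
  have hNpos : ∀ᶠ j in atTop, 1 ≤ N j := hN.eventually_ge_atTop 1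
  -- `n P(X > m_n)` is bounded
  have hθ : (fun j => N j * negBinomialTail r p (centering ξ (N j))) =O[atTop]
      fun _ => (1 : ℝ) := by
    have h := ((tendsto_int_negBinomialTail_succ_div hr hp0 hp1).inv₀ hp0.ne').comp hm
    refine IsBigO.trans (IsBigO.of_bound 1 ?_) (h.isBigO_one ℝ)
    filter_upwards [hNpos] with j hj
    rw [Function.comp_apply, inv_div, one_mul, Real.norm_of_nonneg
      (mul_nonneg (Nat.cast_nonneg _) (hT _).le), Real.norm_of_nonneg
      (div_nonneg (hT _).le (hT _).le)]
    exact (hG.natCast_mul_tail_centering_bounds hr hp0 hp1 hξ hj).2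
  -- `1 / n` is at most of the order of `P(X > m_n + x)`
  have hinvN : (fun j => ((N j : ℝ))⁻¹) =O[atTop]
      fun j => negBinomialTail r p (centering ξ (N j) + x) := by
    have h1 := (tendsto_negBinomialTail_add_div hr hp0 hp1 (-1)).comp hm
    have h2 := ((tendsto_negBinomialTail_add_div hr hp0 hp1 x).comp hm).inv₀
      (zpow_ne_zero x hp0.ne')
    have h3 := ((h1.mul h2).isBigO_one ℝ).mul
      (isBigO_refl (fun j => negBinomialTail r p (centering ξ (N j) + x)) atTop)
    simp only [one_mul] at h3
    refine IsBigO.trans (IsBigO.of_bound 1 ?_) h3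
    filter_upwards [hNpos] with j hj
    have hj' : (0 : ℝ) < N j := by exact_mod_cast hj
    have hb := (hG.natCast_mul_tail_centering_bounds hr hp0 hp1 hξ hj).1
    have e : negBinomialTail r p (centering ξ (N j) + -1) /
          negBinomialTail r p (centering ξ (N j)) *
        (negBinomialTail r p (centering ξ (N j) + x) /
          negBinomialTail r p (centering ξ (N j)))⁻¹ *
        negBinomialTail r p (centering ξ (N j) + x) =
        negBinomialTail r p (centering ξ (N j) + -1) := by
      have := (hT (centering ξ (N j))).ne'
      have := (hT (centering ξ (N j) + x)).ne'
      field_simp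
    simp only [Function.comp_apply]
    rw [e, one_mul, Real.norm_of_nonneg (by positivity), Real.norm_of_nonneg (hT _).le]
    rw [div_le_iff₀ (hT _)] at hb
    have h0 := hT (centering ξ (N j))
    rw [inv_le_iff_one_le_mul₀ hj']
    refine le_of_mul_le_mul_left ?_ h0
    linarith
  have htN : Tendsto (fun j => (((centering ξ (N j) + x).toNat : ℕ) : ℝ) ^ 4 / N j) atTop
      (𝓝 0) := by
    refine IsBigO.trans_tendsto ?_ ((tendsto_pow_four_mul_negBinomialTail hr hp0 hp1).comp ht)
    have h := (isBigO_refl (fun j => (((centering ξ (N j) + x).toNat : ℕ) : ℝ) ^ 4) atTop).mul hinvN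
    refine h.congr' (Eventually.of_forall fun j => (div_eq_mul_inv _ _).symm) ?_
    filter_upwards [hmx.eventually_ge_atTop 0] with j hj
    simp [Int.toNat_of_nonneg hj]
  have hc : (fun j => p ^ x * (N j * negBinomialTail r p (centering ξ (N j)))) =O[atTop]
      fun _ => (1 : ℝ) := hθ.const_mul_left _
  have htail : Tendsto (fun j => N j * negBinomialTail r p ((centering ξ (N j) + x).toNat : ℕ) -
      p ^ x * (N j * negBinomialTail r p (centering ξ (N j)))) atTop (𝓝 0) := by
    have h1 := ((tendsto_negBinomialTail_add_div hr hp0 hp1 x).comp hm).sub_const (p ^ x)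
    rw [sub_self] at h1
    refine (hθ.tendsto_mul_zero h1).congr' ?_
    filter_upwards [hmx.eventually_ge_atTop 0] with j hj
    have := (hT (centering ξ (N j))).ne'
    rw [Int.toNat_of_nonneg hj, Function.comp_apply]
    field_simp
  have hlim := tendsto_cappedProb_mul_exp hr hp0 hp1 hN hK ht htN hc htail
  refine (isEquivalent_iff_tendsto_one (Eventually.of_forall fun j =>
    (Real.rpow_pos_of_pos (Real.exp_pos _) _).ne')).2 (hlim.congr' ?_)
  filter_upwards [hNpos, hmx.eventually_ge_atTop 0] with j hj hj0
  have hj' : (0 : ℝ) < N j := by exact_mod_cast hj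
  have hKpos : 0 < K j := by
    have h1 : 0 < (K j : ℝ) / N j := by
      have := sub_pos.2 hp1
      rw [← hK j]; positivity
    rcases Nat.eq_zero_or_pos (K j) with h0 | h0
    · simp [h0] at h1
    · exact h0
  have hset := dirichletMultinomialMeasure_maxCount_le hr hj hKpos (centering ξ (N j) + x).toNat
  rw [Int.toNat_of_nonneg hj0] at hset
  have hbase : baseProb G ξ (N j) ^ (p ^ x : ℝ) =
      Real.exp (-(p ^ x * (N j * negBinomialTail r p (centering ξ (N j))))) := by
    rw [baseProb, hξ _ hj, hG.eq_tail, ← Real.exp_mul]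
    congr 1
    field_simp
  change _ = (dirichletMultinomialMeasure (N j) (K j) r).real _ /
    (baseProb G ξ (N j) ^ (p ^ x : ℝ))
  rw [hset, hbase, Real.exp_neg, div_inv_eq_mul]
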